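/- Let $n\ge 1$ and let $\mu_n$ be the group of $n$-th roots of unity, acting diagonally on $\mathbb{C}^n$, with quotient map $q:\mathbb{C}^n\setminus\{0\}\to(\mathbb{C}^n\setminus\{0\})/\mu_n$ onto the quotient complex manifold. Let $$\mathcal{O}_{\mathbb{CP}^{n-1}}(-n)=\{(z,[\xi])\in\mathbb{C}^n\times\mathbb{CP}^{n-1} : z^i(\xi^j)^n=z^j(\xi^i)^n \text{ for all } i,j\}$$ with its complex manifold structure, let $\mathbb{CP}^{n-1}=\{z=0\}$ be its zero section, and let $\pi:\mathcal{O}_{\mathbb{CP}^{n-1}}(-n)\setminus\mathbb{CP}^{n-1}\to(\mathbb{C}^n\setminus\{0\})/\mu_n$ be the blow-down map, which sends $(z,[\xi])$ to the class of any $w$ on the line $[\xi]$ with $(w^k)^n=z^k$ for all $k$. Then the form $dz^1\wedge\dots\wedge dz^n$ descends to a holomorphic $n$-form $\eta^{\mathbb{C}}$ on $(\mathbb{C}^n\setminus\{0\})/\mu_n$, that is, $q^*\eta^{\mathbb{C}}=dz^1\wedge\dots\wedge dz^n$, and $\pi^*\eta^{\mathbb{C}}$ extends to a nowhere-vanishing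 holomorphic $n$-form $\eta$ on $\mathcal{O}_{\mathbb{CP}^{n-1}}(-n)$. Moreover, for every $a>0$, the metric (the Ricci-flat Calabi–Eguchi–Hanson metric) that is given off the zero section, in the coordinates $z$ of $\mathbb{C}^n\setminus\{0\}$ and with $u=|z|^2$, by $$g_{\mu\bar\nu}=\sqrt[n]{1+\frac{a^n}{u^n}}\left(\delta_{\mu\bar\nu}-\frac{a^n}{a^n+u^n}\,\frac{\bar z_\mu z_\nu}{u}\right)$$ extends to a smooth Riemannian metric on $\mathcal{O}_{\mathbb{CP}^{n-1}}(-n)$, and $\eta$ is parallel with respect to the Levi-Civita connection of this metric. -/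

import Mathlib

open scoped Manifold ContDiff Topology LinearAlgebra.Projectivization
open Bundle

noncomputable section

namespace CalabiEguchiHanson

/-- The complex Euclidean space `ℂⁿ`. -/
abbrev Cn (n : ℕ) : Type := EuclideanSpace ℂ (Fin n)

/-! ### The total space of `𝒪(-n)` over `ℂℙⁿ⁻¹` as a complex manifold -/

/-- `ℂℙⁿ⁻¹` carries the quotient topology of `ℂⁿ ∖ 0`. -/
instance instTopologicalSpaceProj (n : ℕ) : TopologicalSpace (ℙ ℂ (Cn n)) :=
  inferInstanceAs (TopologicalSpace (Quotient (projectivizationSetoid ℂ (Cn n))))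

/-- The total space of `𝒪(-n)` over `ℂℙⁿ⁻¹`, realised as
`{(z, [ξ]) | zⁱ (ξʲ)ⁿ = zʲ (ξⁱ)ⁿ} ⊆ ℂⁿ × ℂℙⁿ⁻¹`. -/
def OMinus (n : ℕ) : Type :=
  {p : Cn n × ℙ ℂ (Cn n) // ∀ i j, p.1 i * p.2.rep j ^ n = p.1 j * p.2.rep i ^ n}

instance instTopologicalSpaceOMinus (n : ℕ) : TopologicalSpace (OMinus n) :=
  inferInstanceAs (TopologicalSpace
    {p : Cn n × ℙ ℂ (Cn n) // ∀ i j, p.1 i * p.2.rep j ^ n = p.1 j * p.2.rep i ^ n})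

/-- The representative `ξ` with `ξⁱ = 1` of the point of `ℂℙⁿ⁻¹` with affine coordinates `yᵏ`,
`k ≠ i`. -/
def affineRep {n : ℕ} (i : Fin n) (y : Cn n) : Cn n :=
  WithLp.toLp 2 (fun k => if k = i then 1 else y k)

theorem affineRep_ne_zero {n : ℕ} (i : Fin n) (y : Cn n) : affineRep i y ≠ 0 := fun h => by
  have := congrArg (fun v : Cn n => v i) h
  simp [affineRep] at this

theorem contDiff_affineRep {n : ℕ} (i k : Fin n) :
    ContDiff ℂ ω (fun y : Cn n => affineRep i y k) := by
  by_cases hk : k = i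
  · simpa [affineRep, hk] using contDiff_const
  · simp only [affineRep, hk, if_false]; fun_prop

theorem exists_rep_mk {n : ℕ} (ξ : Cn n) (hξ : ξ ≠ 0) :
    ∃ c : ℂ, c ≠ 0 ∧ (Projectivization.mk ℂ ξ hξ).rep = c • ξ := by
  obtain ⟨a, ha⟩ := Projectivization.exists_smul_eq_mk_rep ℂ ξ hξ
  exact ⟨a, a.ne_zero, ha.symm⟩

/-- The affine coordinates `ξᵏ / ξⁱ` of a point of `ℂℙⁿ⁻¹`. -/
def ratio {n : ℕ} (i k : Fin n) (l : ℙ ℂ (Cn n)) : ℂ := l.rep k / l.rep i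

theorem ratio_mk {n : ℕ} (i k : Fin n) (ξ : Cn n) (hξ : ξ ≠ 0) :
    ratio i k (Projectivization.mk ℂ ξ hξ) = ξ k / ξ i := by
  obtain ⟨c, hc, h⟩ := exists_rep_mk ξ hξ
  simp [ratio, h, mul_div_mul_left _ _ hc]

theorem rep_mk_ne_zero_iff {n : ℕ} (i : Fin n) (ξ : Cn n) (hξ : ξ ≠ 0) :
    (Projectivization.mk ℂ ξ hξ).rep i ≠ 0 ↔ ξ i ≠ 0 := by
  obtain ⟨c, hc, h⟩ := exists_rep_mk ξ hξ
  simp [h, hc]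

theorem mk_isQuotientMap (n : ℕ) :
    Topology.IsQuotientMap (fun v : {v : Cn n // v ≠ 0} => Projectivization.mk ℂ v.1 v.2) :=
  isQuotientMap_quot_mk

theorem isOpen_rep_ne_zero {n : ℕ} (i : Fin n) : IsOpen {l : ℙ ℂ (Cn n) | l.rep i ≠ 0} := by
  rw [← (mk_isQuotientMap n).isOpen_preimage]
  have : (fun v : {v : Cn n // v ≠ 0} => Projectivization.mk ℂ v.1 v.2) ⁻¹'
      {l : ℙ ℂ (Cn n) | l.rep i ≠ 0} = {v | v.1 i ≠ 0} := by
    ext v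
    exact rep_mk_ne_zero_iff i v.1 v.2
  rw [this]
  exact isOpen_ne_fun (by fun_prop) continuous_const

theorem continuousOn_ratio {n : ℕ} (i k : Fin n) :
    ContinuousOn (ratio i k) {l : ℙ ℂ (Cn n) | l.rep i ≠ 0} := by
  rw [(mk_isQuotientMap n).continuousOn_isOpen_iff (isOpen_rep_ne_zero i)]
  have h : ContinuousOn (fun v : {v : Cn n // v ≠ 0} => v.1 k / v.1 i)
      ((fun v : {v : Cn n // v ≠ 0} => Projectivization.mk ℂ v.1 v.2) ⁻¹'
        {l : ℙ ℂ (Cn n) | l.rep i ≠ 0}) :=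
    ContinuousOn.div (by fun_prop) (by fun_prop)
      fun v hv => (rep_mk_ne_zero_iff i v.1 v.2).1 hv
  exact h.congr fun v _ => ratio_mk i k v.1 v.2

theorem mk_mem_OMinus {n : ℕ} (ξ : Cn n) (hξ : ξ ≠ 0) (t : ℂ) (i j : Fin n) :
    (WithLp.toLp 2 (fun k => t * ξ k ^ n) : Cn n) i *
        (Projectivization.mk ℂ ξ hξ).rep j ^ n =
      (WithLp.toLp 2 (fun k => t * ξ k ^ n) : Cn n) j *
        (Projectivization.mk ℂ ξ hξ).rep i ^ n := by
  obtain ⟨c, hc, h⟩ := exists_rep_mk ξ hξ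
  simp [h, mul_pow]
  ring

/-- The point `(t (ξ¹)ⁿ, …, t (ξⁿ)ⁿ; [ξ])` of `𝒪(-n)`. -/
def OMinus.mk {n : ℕ} (ξ : Cn n) (hξ : ξ ≠ 0) (t : ℂ) : OMinus n :=
  ⟨(WithLp.toLp 2 (fun k => t * ξ k ^ n), Projectivization.mk ℂ ξ hξ), mk_mem_OMinus ξ hξ t⟩

theorem affineRep_ratio {n : ℕ} (i : Fin n) (l : ℙ ℂ (Cn n)) (hl : l.rep i ≠ 0) (y : Cn n)
    (hy : ∀ k ≠ i, y k = ratio i k l) :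
    affineRep i y = (l.rep i)⁻¹ • l.rep := by
  ext k
  by_cases hk : k = i
  · subst hk; simp [affineRep, hl]
  · simp [affineRep, hk, hy k hk, ratio, div_eq_inv_mul]

/-- The standard chart of `𝒪(-n)` over `{ξⁱ ≠ 0}`: the `i`-th coordinate is the fibre coordinate
`zⁱ`, the others are the affine coordinates `ζᵏ = ξᵏ / ξⁱ`. Its inverse sends `y` to
`((ζ¹)ⁿ zⁱ, …, zⁱ, …, (ζⁿ)ⁿ zⁱ; [ζ¹ : … : 1 : … : ζⁿ])`. -/
def chart {n : ℕ} (i : Fin n) : OpenPartialHomeomorph (OMinus n) (Cn n) where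
  toFun p := WithLp.toLp 2 (fun k => if k = i then p.1.1 i else ratio i k p.1.2)
  invFun y := OMinus.mk (affineRep i y) (affineRep_ne_zero i y) (y i)
  source := {p | p.1.2.rep i ≠ 0}
  target := Set.univ
  map_source' _ _ := Set.mem_univ _
  map_target' y _ := by
    change (Projectivization.mk ℂ (affineRep i y) (affineRep_ne_zero i y)).rep i ≠ 0
    rw [rep_mk_ne_zero_iff]
    simp [affineRep]
  left_inv' := by
    rintro ⟨⟨z, l⟩, h⟩ hl
    change l.rep i ≠ 0 at hl
    have hr : affineRep i (WithLp.toLp 2 (fun k => if k = i then z i else ratio i k l)) =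
        (l.rep i)⁻¹ • l.rep :=
      affineRep_ratio i l hl _ fun k hk => by simp [hk]
    apply Subtype.ext
    apply Prod.ext
    · ext k
      change _ * _ ^ n = z k
      rw [hr]
      have := h i k
      simp only [PiLp.smul_apply, smul_eq_mul, mul_pow, inv_pow, if_true]
      field_simp
      simpa [mul_comm] using this
    · change Projectivization.mk ℂ _ _ = l
      conv_rhs => rw [← l.mk_rep]
      rw [Projectivization.mk_eq_mk_iff']
      exact ⟨_, hr.symm⟩
  right_inv' y _ := by
    ext k
    by_cases hk : k = i
    · subst hk
      simp [OMinus.mk, affineRep]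
    · simp [OMinus.mk, hk, ratio_mk, affineRep]
  open_source := (isOpen_rep_ne_zero i).preimage (continuous_snd.comp continuous_subtype_val)
  open_target := isOpen_univ
  continuousOn_toFun := by
    apply (PiLp.continuous_toLp 2 _).comp_continuousOn
    rw [continuousOn_pi]
    intro k
    by_cases hk : k = i
    · simp only [hk, if_true]
      exact (Continuous.comp (by fun_prop : Continuous fun v : Cn n => v i)
        (continuous_fst.comp continuous_subtype_val)).continuousOn
    · simp only [hk, if_false]
      exact (continuousOn_ratio i k).comp
        (continuous_snd.comp continuous_subtype_val).continuousOn fun p hp => hp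
  continuousOn_invFun := by
    have hc : Continuous (affineRep i : Cn n → Cn n) :=
      (PiLp.continuous_toLp 2 _).comp
        (continuous_pi fun k => (contDiff_affineRep i k).continuous)
    apply Continuous.continuousOn
    apply Continuous.subtype_mk
    apply Continuous.prodMk
    · apply (PiLp.continuous_toLp 2 _).comp
      refine continuous_pi fun k => ?_
      exact Continuous.mul (by fun_prop) ((contDiff_affineRep i k).continuous.pow n)
    · exact (mk_isQuotientMap n).continuous.comp (hc.subtype_mk fun y => affineRep_ne_zero i y)

theorem exists_rep_ne_zero {n : ℕ} (p : OMinus n) : ∃ i, p.1.2.rep i ≠ 0 := by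
  by_contra! h
  exact p.1.2.rep_nonzero (by ext i; simpa using h i)

instance instChartedSpaceOMinus (n : ℕ) : ChartedSpace (Cn n) (OMinus n) where
  atlas := Set.range chart
  chartAt p := chart (exists_rep_ne_zero p).choose
  mem_chart_source p := (exists_rep_ne_zero p).choose_spec
  chart_mem_atlas _ := Set.mem_range_self _

theorem contDiffOn_transition {n : ℕ} (i j : Fin n) :
    ContDiffOn ℂ ω ((chart i).symm ≫ₕ chart j) ((chart i).symm ≫ₕ chart j).source := by
  have hs : ∀ y ∈ ((chart i).symm ≫ₕ chart j).source, affineRep i y j ≠ 0 := by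
    intro y hy
    have h : (Projectivization.mk ℂ (affineRep i y) (affineRep_ne_zero i y)).rep j ≠ 0 := hy.2
    rwa [rep_mk_ne_zero_iff] at h
  have hc := contDiff_affineRep i
  rw [contDiffOn_piLp]
  intro k
  by_cases hk : k = j
  · have : ContDiff ℂ ω (fun y : Cn n => y i * affineRep i y j ^ n) :=
      ContDiff.mul (by fun_prop) ((hc j).pow n)
    refine this.contDiffOn.congr fun y _ => ?_
    change (if k = j then y i * affineRep i y j ^ n else _) = _
    simp [hk]
  · refine (ContDiffOn.div (hc k).contDiffOn (hc j).contDiffOn hs).congr fun y _ => ?_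
    change (if k = j then _ else ratio j k (Projectivization.mk ℂ (affineRep i y) _)) = _
    simp [hk, ratio_mk]

instance instIsManifoldOMinus (n : ℕ) : IsManifold 𝓘(ℂ, Cn n) ω (OMinus n) := by
  apply isManifold_of_contDiffOn
  rintro _ _ ⟨i, rfl⟩ ⟨j, rfl⟩
  simpa using contDiffOn_transition i j

instance instIsManifoldOMinusReal (n : ℕ) : IsManifold 𝓘(ℝ, Cn n) ω (OMinus n) := by
  apply isManifold_of_contDiffOn
  rintro _ _ ⟨i, rfl⟩ ⟨j, rfl⟩
  simpa using (contDiffOn_transition i j).restrict_scalars ℝ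

/-! ### The complex manifold `(ℂⁿ ∖ 0) / μₙ` -/

/-- `ℂⁿ ∖ 0`. -/
def punctured (n : ℕ) : TopologicalSpace.Opens (Cn n) := ⟨{0}ᶜ, isOpen_compl_singleton⟩

theorem punctured_ne_zero {n : ℕ} (z : punctured n) : (z : Cn n) ≠ 0 := z.2

/-- The diagonal action of the `n`-th roots of unity on `ℂⁿ ∖ 0`. -/
instance instMulActionPunctured (n : ℕ) : MulAction (rootsOfUnity n ℂ) (punctured n) where
  smul ζ z := ⟨ζ • (z : Cn n), fun h => punctured_ne_zero z (by
    simpa [Subgroup.smul_def, Units.smul_def] using h)⟩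
  one_smul z := Subtype.ext (one_smul _ (z : Cn n))
  mul_smul ζ ζ' z := Subtype.ext (mul_smul ζ ζ' (z : Cn n))

theorem coe_smul {n : ℕ} (ζ : rootsOfUnity n ℂ) (z : punctured n) :
    ((ζ • z : punctured n) : Cn n) = ((ζ : ℂˣ) : ℂ) • (z : Cn n) := rfl

instance instContinuousConstSMulPunctured (n : ℕ) :
    ContinuousConstSMul (rootsOfUnity n ℂ) (punctured n) where
  continuous_const_smul ζ := Continuous.subtype_mk
    (continuous_subtype_val.const_smul ((ζ : ℂˣ) : ℂ)) _

instance instIsCancelSMulPunctured (n : ℕ) : IsCancelSMul (rootsOfUnity n ℂ) (punctured n) where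
  right_cancel' ζ ζ' z h := by
    have h' := congrArg (fun w : punctured n => (w : Cn n)) h
    simp only [coe_smul] at h'
    exact Subtype.ext (Units.ext (smul_left_injective ℂ (punctured_ne_zero z) h'))

instance instLocallyCompactSpacePunctured (n : ℕ) : LocallyCompactSpace (punctured n) :=
  (punctured n).isOpen.locallyCompactSpace

/-- The quotient `(ℂⁿ ∖ 0) / μₙ`, with the manifold structure of Mathlib on the quotient by a free
properly discontinuous action: the charts are local inverses of the quotient map. -/
abbrev PuncturedQuotient (n : ℕ) [NeZero n] : Type :=
  MulAction.orbitRel.Quotient (rootsOfUnity n ℂ) (punctured n)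

/-- The quotient map `ℂⁿ ∖ 0 → (ℂⁿ ∖ 0) / μₙ`. -/
def quotientMap (n : ℕ) [NeZero n] (z : punctured n) : PuncturedQuotient n := Quotient.mk'' z

theorem quotientMap_isLocalHomeomorph (n : ℕ) [NeZero n] :
    IsLocalHomeomorph (quotientMap n) :=
  (isQuotientCoveringMap_quotientMk_of_properlyDiscontinuousSMul
    (G := rootsOfUnity n ℂ) (E := punctured n)).isCoveringMap.isLocalHomeomorph

theorem quotientMap_eq_iff {n : ℕ} [NeZero n] {z w : punctured n} :
    quotientMap n z = quotientMap n w ↔ ∃ ζ : rootsOfUnity n ℂ, ζ • w = z :=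
  Quotient.eq''.trans MulAction.orbitRel_apply

theorem chart_puncturedQuotient {n : ℕ} [NeZero n]
    {e : OpenPartialHomeomorph (PuncturedQuotient n) (Cn n)}
    (he : e ∈ atlas (Cn n) (PuncturedQuotient n)) :
    (∀ y ∈ e.target, ∃ z : punctured n, (z : Cn n) = y ∧ e.symm y = quotientMap n z) ∧
    (∀ z : punctured n, (z : Cn n) ∈ e.target → e (quotientMap n z) = z) := by
  have hl := quotientMap_isLocalHomeomorph n
  obtain ⟨x, rfl⟩ : ∃ x : punctured n,
      (hl.localInverseAt x).trans (chartAt (Cn n) x) = e := by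
    obtain ⟨q, hq⟩ := he
    exact ⟨_, hq⟩
  have hsymm : ∀ y ∈ ((hl.localInverseAt x).trans (chartAt (Cn n) x)).target,
      ∃ z : punctured n, (z : Cn n) = y ∧
        ((hl.localInverseAt x).trans (chartAt (Cn n) x)).symm y = quotientMap n z := by
    intro y hy
    refine ⟨(chartAt (Cn n) x).symm y, (chartAt (Cn n) x).right_inv hy.1, ?_⟩
    exact congrFun (hl.localInverseAt_symm x) _
  refine ⟨hsymm, fun z hz => ?_⟩
  obtain ⟨w, hw, h⟩ := hsymm _ hz
  obtain rfl : w = z := Subtype.ext hw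
  rw [← h]
  exact OpenPartialHomeomorph.right_inv _ hz

theorem contDiffOn_transition_quotient {n : ℕ} [NeZero n]
    {e e' : OpenPartialHomeomorph (PuncturedQuotient n) (Cn n)}
    (he : e ∈ atlas (Cn n) (PuncturedQuotient n))
    (he' : e' ∈ atlas (Cn n) (PuncturedQuotient n)) :
    ContDiffOn ℂ ω (e.symm ≫ₕ e') (e.symm ≫ₕ e').source := by
  intro y hy
  obtain ⟨z, hzy, hz⟩ := (chart_puncturedQuotient he).1 y hy.1
  have hy' : e' (e.symm y) ∈ e'.target := e'.map_source hy.2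
  obtain ⟨w, hwy, hw⟩ := (chart_puncturedQuotient he').1 _ hy'
  have hleft : e'.symm (e' (e.symm y)) = e.symm y := e'.left_inv hy.2
  rw [hleft, hz, eq_comm, quotientMap_eq_iff] at hw
  obtain ⟨ζ, rfl⟩ := hw
  rw [coe_smul, hzy] at hwy
  have hc : Continuous fun v : Cn n => ((ζ : ℂˣ) : ℂ) • v := by fun_prop
  have hev : ∀ᶠ v in 𝓝 y, (e.symm ≫ₕ e') v = ((ζ : ℂˣ) : ℂ) • v := by
    have h1 : ∀ᶠ v in 𝓝 y, v ∈ e.target := e.open_target.mem_nhds hy.1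
    have h2 : ∀ᶠ v in 𝓝 y, ((ζ : ℂˣ) : ℂ) • v ∈ e'.target :=
      hc.continuousAt.eventually_mem (e'.open_target.mem_nhds (by simpa only [hwy] using hy'))
    filter_upwards [h1, h2] with v hv1 hv2
    obtain ⟨z', rfl, hz'⟩ := (chart_puncturedQuotient he).1 v hv1
    have : quotientMap n z' = quotientMap n (ζ • z') :=
      (quotientMap_eq_iff.2 ⟨ζ, rfl⟩).symm
    change e' (e.symm _) = _
    rw [hz', this]
    exact (chart_puncturedQuotient he').2 (ζ • z') hv2
  have hd : ContDiff ℂ ω fun v : Cn n => ((ζ : ℂˣ) : ℂ) • v := by fun_prop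
  exact (hd.contDiffAt.congr_of_eventuallyEq hev).contDiffWithinAt

instance instIsManifoldPuncturedQuotient (n : ℕ) [NeZero n] :
    IsManifold 𝓘(ℂ, Cn n) ω (PuncturedQuotient n) := by
  apply isManifold_of_contDiffOn
  intro e e' he he'
  simpa using contDiffOn_transition_quotient he he'

/-! ### The blow-down map -/

/-- The complement of the zero section in `𝒪(-n)`. -/
def offZeroSection (n : ℕ) : TopologicalSpace.Opens (OMinus n) :=
  ⟨{p | p.1.1 ≠ 0}, isOpen_ne_fun (continuous_fst.comp continuous_subtype_val) continuous_const⟩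

/-- `w` is an `n`-th root of the point `(z, [ξ])` of `𝒪(-n)`: it lies on the line `[ξ]`, and
`(wᵏ)ⁿ = zᵏ` for all `k`. -/
def IsRoot {n : ℕ} (p : OMinus n) (w : punctured n) : Prop :=
  (∀ k, (w : Cn n) k ^ n = p.1.1 k) ∧
    Projectivization.mk ℂ (w : Cn n) (punctured_ne_zero w) = p.1.2

theorem exists_isRoot {n : ℕ} [NeZero n] (p : offZeroSection n) :
    ∃ w : punctured n, IsRoot p.1 w := by
  obtain ⟨⟨⟨z, l⟩, h⟩, hz⟩ := p
  change z ≠ 0 at hz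
  obtain ⟨i, hi⟩ : ∃ i, l.rep i ≠ 0 := exists_rep_ne_zero ⟨(z, l), h⟩
  obtain ⟨t, ht⟩ := IsAlgClosed.exists_pow_nat_eq (z i / l.rep i ^ n) (NeZero.pos n)
  have key : ∀ k, (t • l.rep : Cn n) k ^ n = z k := by
    intro k
    have := h i k
    simp only [PiLp.smul_apply, smul_eq_mul, mul_pow, ht]
    field_simp
    simpa [mul_comm] using this
  have h0 : (t • l.rep : Cn n) ≠ 0 := by
    intro h0
    apply hz
    ext k
    rw [← key k, h0]
    simp [NeZero.ne n]
  refine ⟨⟨t • l.rep, h0⟩, key, ?_⟩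
  exact ((Projectivization.mk_eq_mk_iff' ℂ _ _ _ l.rep_nonzero).2 ⟨t, rfl⟩).trans l.mk_rep

/-- The blow-down map `π`, restricted to the complement of the zero section: `(z, [ξ])` is sent to
the class modulo `μₙ` of its `n`-th roots. -/
def blowDown (n : ℕ) [NeZero n] (p : offZeroSection n) : PuncturedQuotient n :=
  quotientMap n (exists_isRoot p).choose

/-- The blow-down map does not depend on the chosen root. -/
theorem blowDown_eq {n : ℕ} [NeZero n] (p : offZeroSection n) (w : punctured n)
    (hw : IsRoot p.1 w) : blowDown n p = quotientMap n w := by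
  obtain ⟨h1, h2⟩ := (exists_isRoot p).choose_spec
  rw [blowDown, quotientMap_eq_iff]
  obtain ⟨a, ha⟩ := (Projectivization.mk_eq_mk_iff ℂ _ _ _ _).1 (h2.trans hw.2.symm)
  obtain ⟨k, hk⟩ : ∃ k, (w : Cn n) k ≠ 0 := by
    by_contra! h
    exact punctured_ne_zero w (by ext k; simpa using h k)
  have hak : (a : ℂ) ^ n = 1 := by
    have e1 := h1 k
    rw [← ha, ← hw.1 k] at e1
    change ((a : ℂ) * (w : Cn n) k) ^ n = _ at e1
    rw [mul_pow] at e1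
    exact mul_right_cancel₀ (pow_ne_zero n hk) (by rw [e1, one_mul])
  exact ⟨⟨a, (mem_rootsOfUnity _ _).2 (Units.ext (by simpa using hak))⟩, Subtype.ext ha⟩

/-- The map `ℂⁿ ∖ 0 → 𝒪(-n)`, `z ↦ ((z¹)ⁿ, …, (zⁿ)ⁿ; [z])`. -/
def cover (n : ℕ) (z : punctured n) : OMinus n := OMinus.mk (z : Cn n) (punctured_ne_zero z) 1

theorem isRoot_cover {n : ℕ} (z : punctured n) : IsRoot (cover n z) z :=
  ⟨fun _ => (one_mul _).symm, rfl⟩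

theorem cover_mem {n : ℕ} [NeZero n] (z : punctured n) : cover n z ∈ offZeroSection n := by
  intro h
  apply punctured_ne_zero z
  ext k
  have := (isRoot_cover z).1 k
  rw [h] at this
  simpa [NeZero.ne n] using this

/-- `cover` is the quotient map `ℂⁿ ∖ 0 → (ℂⁿ ∖ 0) / μₙ` followed by the inverse of `π`. -/
theorem blowDown_cover {n : ℕ} [NeZero n] (z : punctured n) :
    blowDown n ⟨cover n z, cover_mem z⟩ = quotientMap n z :=
  blowDown_eq _ _ (isRoot_cover z)

/-! ### Holomorphic forms -/

section Forms

variable {n : ℕ} {M N : Type} [TopologicalSpace M] [ChartedSpace (Cn n) M]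
  [TopologicalSpace N] [ChartedSpace (Cn n) N]

/-- Fields of complex multilinear alternating `n`-forms, i.e. forms of type `(n, 0)`, on an
`n`-dimensional complex manifold, without regularity. -/
abbrev TopForm (n : ℕ) (M : Type) [TopologicalSpace M] [ChartedSpace (Cn n) M] : Type :=
  ∀ x : M, TangentSpace 𝓘(ℂ, Cn n) x [⋀^Fin n]→L[ℂ] ℂ

/-- The pullback of an `n`-form. -/
def TopForm.pullback (f : M → N) (α : TopForm n N) : TopForm n M := fun x =>
  (α (f x)).compContinuousLinearMap (mfderiv 𝓘(ℂ, Cn n) 𝓘(ℂ, Cn n) f x)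

/-- An `n`-form is holomorphic if its expression in each chart is. -/
def TopForm.IsHolomorphic (α : TopForm n M) : Prop :=
  ∀ e ∈ atlas (Cn n) M,
    DifferentiableOn ℂ (F := Cn n [⋀^Fin n]→L[ℂ] ℂ)
      (TopForm.pullback (M := Cn n) e.symm α) e.target

/-- The alternating form `dz¹ ∧ … ∧ dzⁿ`, `(v₁, …, vₙ) ↦ det (vⱼᵏ)`. -/
def dzForm (n : ℕ) : Cn n [⋀^Fin n]→L[ℂ] ℂ :=
  { (Matrix.detRowAlternating (n := Fin n) (R := ℂ)).compLinearMap
      (WithLp.linearEquiv 2 ℂ (Fin n → ℂ)).toLinearMap with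
    cont := by
      change Continuous fun v : Fin n → Cn n => Matrix.det (fun j k => v j k)
      exact Continuous.matrix_det (by fun_prop) }

theorem dzForm_apply (n : ℕ) (v : Fin n → Cn n) :
    dzForm n v = Matrix.det (Matrix.of fun j k => v j k) := rfl

/-- The form `dz¹ ∧ … ∧ dzⁿ` on the manifold `ℂⁿ`. -/
def stdForm (n : ℕ) : TopForm n (Cn n) := fun _ => dzForm n

end Forms

/-! ### The Ricci-flat metric, its Levi-Civita connection, parallel forms -/

/-- The Hermitian matrix `g_{μν̄} = (1 + aⁿ/uⁿ)^{1/n} (δ_{μν} - aⁿ/(aⁿ + uⁿ) · z̄_μ z_ν / u)`,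
`u = |z|²`, of the Calabi-Eguchi-Hanson metric with parameter `a` at `z ∈ ℂⁿ ∖ 0`. -/
def metricMatrix {n : ℕ} (a : ℝ) (z : Cn n) : Matrix (Fin n) (Fin n) ℂ := fun μ ν =>
  letI u : ℝ := ‖z‖ ^ 2
  (((1 + a ^ n / u ^ n) ^ (1 / n : ℝ) : ℝ) : ℂ) *
    ((if μ = ν then 1 else 0) -
      ((a ^ n / (a ^ n + u ^ n) : ℝ) : ℂ) * ((starRingEnd ℂ) (z μ) * z ν / (u : ℂ)))

/-- The underlying Riemannian metric `(v, w) ↦ Re ∑ g_{μν̄} v^μ w̄^ν`. -/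
def metricOnPunctured {n : ℕ} (a : ℝ) (z v w : Cn n) : ℝ :=
  (∑ μ, ∑ ν, metricMatrix a z μ ν * v μ * (starRingEnd ℂ) (w ν)).re

/-- Smooth Riemannian metrics on `𝒪(-n)`. -/
abbrev Metric (n : ℕ) : Type :=
  ContMDiffRiemannianMetric 𝓘(ℝ, Cn n) ∞ (Cn n)
    (fun x : OMinus n => TangentSpace 𝓘(ℝ, Cn n) x)

/-- `g` is the Ricci-flat Calabi-Eguchi-Hanson metric with parameter `a`: a smooth Riemannian metric
on all of `𝒪(-n)` which off the zero section, identified with `(ℂⁿ ∖ 0) / μₙ` by the blow-down map,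
is given by `metricOnPunctured a` in the standard coordinates of `ℂⁿ ∖ 0`. -/
def IsCalabiEguchiHanson {n : ℕ} (a : ℝ) (g : Metric n) : Prop :=
  ∀ (z : punctured n) (v w : TangentSpace 𝓘(ℝ, Cn n) z),
    g.inner (cover n z)
      (mfderiv 𝓘(ℝ, Cn n) 𝓘(ℝ, Cn n) (cover n) z v)
      (mfderiv 𝓘(ℝ, Cn n) 𝓘(ℝ, Cn n) (cover n) z w) = metricOnPunctured a z v w

/-- Covariant derivatives on the real tangent bundle of `𝒪(-n)`. -/
abbrev Connection (n : ℕ) : Type :=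
  CovariantDerivative 𝓘(ℝ, Cn n) (Cn n) (fun x : OMinus n => TangentSpace 𝓘(ℝ, Cn n) x)

/-- The covariant derivative `∇` is the Levi-Civita connection of `g`: it is torsion-free and
compatible with `g`. -/
def IsLeviCivita {n : ℕ} (g : Metric n) (nabla : Connection n) : Prop :=
  nabla.torsion = 0 ∧
    letI : RiemannianBundle (fun x : OMinus n => TangentSpace 𝓘(ℝ, Cn n) x) :=
      ⟨g.toRiemannianMetric⟩
    nabla.IsMetricCompatible

/-- `∇ η = 0`: one has `d(η(W₁, …, Wₙ))(v) = ∑ⱼ η(W₁, …, ∇ᵥ Wⱼ, …, Wₙ)` at each point `x`, for all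
tangent vectors `v` at `x` and all real vector fields `W₁, …, Wₙ` that are differentiable at `x`. -/
def IsParallel {n : ℕ} (nabla : Connection n) (η : TopForm n (OMinus n)) : Prop :=
  ∀ (x : OMinus n) (W : Fin n → ∀ p : OMinus n, TangentSpace 𝓘(ℝ, Cn n) p),
    (∀ j, MDifferentiableAt 𝓘(ℝ, Cn n) (𝓘(ℝ, Cn n).prod 𝓘(ℝ, Cn n))
      (fun p => (⟨p, W j p⟩ : TangentBundle 𝓘(ℝ, Cn n) (OMinus n))) x) →
    ∀ v : TangentSpace 𝓘(ℝ, Cn n) x,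
      mvfderiv 𝓘(ℝ, Cn n) (fun p => η p (fun j => W j p)) x v =
        ∑ j, η x (Function.update (fun k => W k x) j (nabla (W j) x v))

end CalabiEguchiHanson

end

noncomputable section

set_option maxSynthPendingDepth 3
set_option linter.unusedSectionVars false

/-! Everything is transported along `cover`, the map `z ↦ ((z¹)ⁿ, …, (zⁿ)ⁿ; [z])` from `ℂⁿ ∖ 0` onto
the complement of the zero section. Over `{ξⁱ ≠ 0}` it reads `yⁱ = (zⁱ)ⁿ`, `yᵏ = zᵏ / zⁱ`; call this
expression `ψ`. Its Jacobian determinant is the constant `n` (`dzForm_coverDeriv`). Hence `n⁻¹ dy¹ ∧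
… ∧ dyⁿ` pulls back to `dz¹ ∧ … ∧ dzⁿ` in every standard chart, the transition maps have determinant
1 (`dzForm_fderiv_transition`), and these constant forms glue to `η`. Descent to the quotient by
`μₙ` is the identity `ζⁿ = 1`.

For the metric, put `p = (1 + aⁿ/uⁿ)^{1/n}` and `d = aⁿ/(aⁿ + uⁿ)`. On the orthogonal complement of
the line through `z` it is `p` times the flat metric, on the line itself `p (1 - d)` times. Since `p
u = (aⁿ + uⁿ)^{1/n}` and `1 - d = uⁿ/(aⁿ + uⁿ)`, the coefficients in the charts of `𝒪(-n)` involve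
real powers of `aⁿ + uⁿ` only, which stays positive at `u = 0`. So the formula extends smoothly and
positively over the zero section (`chartMetric_coverDeriv`, `contDiff_chartMetric`,
`chartMetric_pos`).

As `η` has constant coefficients, `∇ η = 0` says that the Christoffel endomorphism `Γ(u, ·)`
contributes no trace. In the coordinates `z` the symbols are `radialChristoffel`, complex bilinear
and trace-free (`sum_dzForm_radialChristoffel`). Passing to a chart of `𝒪(-n)` subtracts `ψ''`,
whose trace contribution is the derivative of the constant determinant of `ψ'`, hence zero. The
trace thus vanishes off the zero section and, by continuity, on it (`sum_dzForm_chartChristoffel`).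

The same density argument determines the metric in each chart (`metricRep_eq_chartMetric`), and the
Levi-Civita connection is unique on differentiable fields (`IsLeviCivita.apply_eq`), so the
conclusion holds for every admissible metric and connection. -/

namespace CalabiEguchiHanson

/-! ### Christoffel symbols of a family of inner products -/

section Christoffel

variable {E : Type} [NormedAddCommGroup E] [NormedSpace ℝ E]

/-- The Koszul expression
`(u, v, w) ↦ (D u (v, w) + D v (u, w) - D w (u, v)) / 2` of the derivative `D` of a metric. -/
def koszul (D : E →L[ℝ] E →L[ℝ] E →L[ℝ] ℝ) : E →L[ℝ] E →L[ℝ] E →L[ℝ] ℝ :=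
  (1 / 2 : ℝ) • (D + D.flip -
    (ContinuousLinearMap.flipₗᵢ ℝ E E ℝ : (E →L[ℝ] E →L[ℝ] ℝ) →L[ℝ] (E →L[ℝ] E →L[ℝ] ℝ)).comp
      D.flip)

theorem koszul_apply (D : E →L[ℝ] E →L[ℝ] E →L[ℝ] ℝ) (u v w : E) :
    koszul D u v w = (D u v w + D v u w - D w u v) / 2 := by
  simp [koszul]
  ring

/-- The two other terms of the Koszul expression are exchanged with opposite signs when `v` and `w`
are swapped. This is metric compatibility, as `koszul_comm` is absence of torsion. -/
theorem koszul_add_koszul {D : E →L[ℝ] E →L[ℝ] E →L[ℝ] ℝ} (hD : ∀ u v w, D u v w = D u w v)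
    (u v w : E) : koszul D u v w + koszul D u w v = D u v w := by
  rw [koszul_apply, koszul_apply, hD u w v, hD v u w, hD w u v]
  ring

theorem koszul_comm {D : E →L[ℝ] E →L[ℝ] E →L[ℝ] ℝ} (hD : ∀ u v w, D u v w = D u w v)
    (u v : E) : koszul D u v = koszul D v u := by
  ext w
  rw [koszul_apply, koszul_apply, hD w u v]
  ring

/-- The Christoffel symbols at a point of a metric with value `G` and derivative `D` there. -/
def christoffel (G : E →L[ℝ] E →L[ℝ] ℝ) (D : E →L[ℝ] E →L[ℝ] E →L[ℝ] ℝ) : E →L[ℝ] E →L[ℝ] E :=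
  (ContinuousLinearMap.compL ℝ E (E →L[ℝ] ℝ) E G.inverse).comp (koszul D)

theorem christoffel_apply (G : E →L[ℝ] E →L[ℝ] ℝ) (D : E →L[ℝ] E →L[ℝ] E →L[ℝ] ℝ) (u v : E) :
    christoffel G D u v = G.inverse (koszul D u v) := rfl

theorem christoffel_comm (G : E →L[ℝ] E →L[ℝ] ℝ) {D : E →L[ℝ] E →L[ℝ] E →L[ℝ] ℝ}
    (hD : ∀ u v w, D u v w = D u w v) (u v : E) :
    christoffel G D u v = christoffel G D v u := by
  rw [christoffel_apply, christoffel_apply, koszul_comm hD]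

/-- A tensor that is symmetric in its first two and antisymmetric in its last two arguments
vanishes. -/
theorem eq_zero_of_symm_of_antisymm {A : Type} {β : A → A → A → ℝ}
    (h1 : ∀ u v w, β u v w = β v u w) (h2 : ∀ u v w, β u v w + β u w v = 0) (u v w : A) :
    β u v w = 0 := by
  have a1 := h2 u v w
  have a2 := h2 v w u
  have a3 := h2 w u v
  have b1 := h1 u v w
  have b2 := h1 u w v
  have b3 := h1 v w u
  linarith

/-- Uniqueness of the Levi-Civita connection at one point: the difference of the two symbols,
lowered by `G`, is symmetric in the first pair and antisymmetric in the last pair of arguments. -/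
theorem eq_of_torsion_eq_of_metric_eq {G : E →L[ℝ] E →L[ℝ] ℝ} (hG : ∀ v, v ≠ 0 → 0 < G v v)
    (hs : ∀ v w, G v w = G w v) {a b : E → E → E}
    (ht : ∀ u v, a u v - a v u = b u v - b v u)
    (hm : ∀ u v w, G (a u v) w + G v (a u w) = G (b u v) w + G v (b u w)) : a = b := by
  have h := eq_zero_of_symm_of_antisymm (β := fun u v w => G (a u v - b u v) w)
    (fun u v w => by
      rw [show a u v - b u v = a v u - b v u by
        rw [sub_eq_sub_iff_sub_eq_sub]; exact ht u v])
    (fun u v w => by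
      have := hm u v w
      rw [hs v, hs v] at this
      simp only [map_sub, sub_apply]
      linarith)
  ext1 u
  ext1 v
  by_contra h0
  exact (hG _ (sub_ne_zero.2 h0)).ne' (h u v _)

variable [FiniteDimensional ℝ E]

/-- Definiteness kills the kernel, and `E` has the dimension of its dual. -/
theorem isInvertible_of_posDef {G : E →L[ℝ] E →L[ℝ] ℝ} (hG : ∀ v, v ≠ 0 → 0 < G v v) :
    ∃ e : E ≃L[ℝ] (E →L[ℝ] ℝ), (e : E →L[ℝ] E →L[ℝ] ℝ) = G := by
  have hinj : Function.Injective (G : E →ₗ[ℝ] E →L[ℝ] ℝ) := by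
    rw [injective_iff_map_eq_zero]
    intro v hv
    by_contra h
    have := hG v h
    have h0 : G v = 0 := hv
    simp [h0] at this
  have hrank : Module.finrank ℝ E = Module.finrank ℝ (E →L[ℝ] ℝ) := by
    rw [← (LinearMap.toContinuousLinearMap (𝕜 := ℝ) (E := E) (F' := ℝ)).finrank_eq]
    exact Subspace.dual_finrank_eq.symm
  refine ⟨(LinearEquiv.ofInjectiveOfFinrankEq (G : E →ₗ[ℝ] E →L[ℝ] ℝ) hinj
    hrank).toContinuousLinearEquiv, ?_⟩
  ext v w
  rfl

theorem inner_christoffel {G : E →L[ℝ] E →L[ℝ] ℝ} (hG : ∀ v, v ≠ 0 → 0 < G v v)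
    (D : E →L[ℝ] E →L[ℝ] E →L[ℝ] ℝ) (u v w : E) :
    G (christoffel G D u v) w = koszul D u v w := by
  obtain ⟨e, rfl⟩ := isInvertible_of_posDef hG
  rw [christoffel_apply, ContinuousLinearMap.inverse_equiv]
  simp

theorem inner_christoffel_add {G : E →L[ℝ] E →L[ℝ] ℝ} (hG : ∀ v, v ≠ 0 → 0 < G v v)
    (hs : ∀ v w, G v w = G w v) {D : E →L[ℝ] E →L[ℝ] E →L[ℝ] ℝ}
    (hD : ∀ u v w, D u v w = D u w v) (u v w : E) :
    G (christoffel G D u v) w + G v (christoffel G D u w) = D u v w := by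
  rw [hs v, inner_christoffel hG, inner_christoffel hG, koszul_add_koszul hD]

/-- Inversion of operators is continuous at an invertible one. This continuity carries trace
identities across the zero section. -/
theorem continuousAt_christoffel {X : Type} [TopologicalSpace X] {G : X → E →L[ℝ] E →L[ℝ] ℝ}
    {D : X → E →L[ℝ] E →L[ℝ] E →L[ℝ] ℝ} {x : X} (hG : ContinuousAt G x) (hD : ContinuousAt D x)
    (hpos : ∀ v, v ≠ 0 → 0 < G x v v) (u v : E) :
    ContinuousAt (fun y => christoffel (G y) (D y) u v) x := by
  obtain ⟨e, he⟩ := isInvertible_of_posDef hpos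
  have hinv : ContinuousAt (fun y => (G y).inverse) x := by
    have h1 : ContinuousAt ContinuousLinearMap.inverse (G x) := by
      rw [← he]
      exact (contDiffAt_map_inverse (𝕜 := ℝ) (n := 0) e).continuousAt
    exact h1.comp hG
  have hK : ContinuousAt (fun y => koszul (D y) u v) x := by
    have h1 : ContinuousAt (fun y => D y u v) x :=
      (hD.clm_apply continuousAt_const).clm_apply continuousAt_const
    have h2 : ContinuousAt (fun y => D y v u) x :=
      (hD.clm_apply continuousAt_const).clm_apply continuousAt_const
    have h3 : ContinuousAt (fun y => (D y).flip u) x :=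
      ((ContinuousLinearMap.flipₗᵢ ℝ E E (E →L[ℝ] ℝ)).continuous.continuousAt.comp hD).clm_apply
        continuousAt_const
    have h4 : ContinuousAt (fun y => ((D y).flip u).flip v) x :=
      ((ContinuousLinearMap.flipₗᵢ ℝ E E ℝ).continuous.continuousAt.comp h3).clm_apply
        continuousAt_const
    exact ((h1.add h2).sub h4).const_smul (1 / 2 : ℝ)
  exact hinv.clm_apply hK

end Christoffel

/-! ### The Levi-Civita connection of a Riemannian metric -/

section LeviCivita

variable {E : Type} [NormedAddCommGroup E] [NormedSpace ℝ E]
  {M : Type} [TopologicalSpace M] [ChartedSpace E M] [IsManifold 𝓘(ℝ, E) ω M]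

/-- Smooth Riemannian metrics on the manifold `M`. -/
abbrev TangentMetric (E M : Type) [NormedAddCommGroup E] [NormedSpace ℝ E]
    [TopologicalSpace M] [ChartedSpace E M] [IsManifold 𝓘(ℝ, E) ω M] :=
  ContMDiffRiemannianMetric 𝓘(ℝ, E) ∞ E (fun x : M => TangentSpace 𝓘(ℝ, E) x)

/-- The coordinates, in the preferred chart at `x`, of the tangent vectors at `p`. -/
def tangentTo (x p : M) : E →L[ℝ] E :=
  (trivializationAt E (TangentSpace 𝓘(ℝ, E)) x).continuousLinearMapAt ℝ p

/-- The tangent vector at `p` with given coordinates in the preferred chart at `x`. -/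
def tangentSymm (x p : M) : E →L[ℝ] E :=
  (trivializationAt E (TangentSpace 𝓘(ℝ, E)) x).symmL ℝ p

theorem tangentTo_tangentSymm {x p : M} (hp : p ∈ (chartAt E x).source) (v : E) :
    tangentTo x p (tangentSymm x p v) = v :=
  (trivializationAt E (TangentSpace 𝓘(ℝ, E)) x).continuousLinearMapAt_symmL (R := ℝ)
    (by simpa using hp) v

theorem tangentSymm_tangentTo {x p : M} (hp : p ∈ (chartAt E x).source) (v : E) :
    tangentSymm x p (tangentTo x p v) = v :=
  (trivializationAt E (TangentSpace 𝓘(ℝ, E)) x).symmL_continuousLinearMapAt (R := ℝ)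
    (by simpa using hp) v

/-- The tangent space at `x` is itself modelled on the preferred chart at `x`, so over `x` the
trivialisation is the identity. All pointwise formulas below are evaluated there. -/
theorem tangentTo_self (x : M) (v : E) : tangentTo x x v = v := by
  have h := TangentBundle.continuousLinearMapAt_trivializationAt (I := 𝓘(ℝ, E))
    (mem_chart_source E x)
  rw [mfderiv_extChartAt_self] at h
  exact DFunLike.congr_fun h v

theorem tangentSymm_self (x : M) (v : E) : tangentSymm x x v = v := by
  conv_lhs => rw [← tangentTo_self x v]
  exact tangentSymm_tangentTo (mem_chart_source E x) v

/-- The inner product on the tangent space at `p`. -/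
def metricAt (g : TangentMetric E M) (p : M) : E →L[ℝ] E →L[ℝ] ℝ := g.inner p

/-- The inner product at `p` in the preferred chart at `x`. -/
def metricRep (g : TangentMetric E M) (x p : M) : E →L[ℝ] E →L[ℝ] ℝ :=
  (metricAt g p).bilinearComp (tangentSymm x p) (tangentSymm x p)

theorem metricRep_apply (g : TangentMetric E M) (x p : M) (v w : E) :
    metricRep g x p v w = metricAt g p (tangentSymm x p v) (tangentSymm x p w) := rfl

theorem metricRep_self (g : TangentMetric E M) (x : M) : metricRep g x x = metricAt g x := by
  ext v w
  rw [metricRep_apply, tangentSymm_self, tangentSymm_self]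

theorem metricAt_symm (g : TangentMetric E M) (p : M) (v w : E) :
    metricAt g p v w = metricAt g p w v := g.symm p v w

theorem metricAt_pos (g : TangentMetric E M) (p : M) (v : E) (hv : v ≠ 0) :
    0 < metricAt g p v v := g.pos p v hv

theorem metricRep_tangentTo (g : TangentMetric E M) {x p : M} (hp : p ∈ (chartAt E x).source)
    (v w : E) : metricRep g x p (tangentTo x p v) (tangentTo x p w) = metricAt g p v w := by
  rw [metricRep_apply, tangentSymm_tangentTo hp, tangentSymm_tangentTo hp]

/-- The trivialisation of the bundle of bilinear forms is precomposition with `tangentSymm` in both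
slots, so smoothness of a metric is smoothness of its matrix `metricRep` in the chart. -/
theorem hom_trivializationAt_apply_tangent {x p : M} (hp : p ∈ (chartAt E x).source)
    (B : E →L[ℝ] E →L[ℝ] ℝ) (v w : E) :
    (trivializationAt (E →L[ℝ] E →L[ℝ] ℝ)
      (fun p : M => TangentSpace 𝓘(ℝ, E) p →L[ℝ] TangentSpace 𝓘(ℝ, E) p →L[ℝ] ℝ) x ⟨p, B⟩).2 v w =
     B (tangentSymm x p v) (tangentSymm x p w) := by
  rw [hom_trivializationAt_apply, ContinuousLinearMap.inCoordinates]
  simp only [ContinuousLinearMap.comp_apply]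
  rw [Trivialization.continuousLinearMapAt_apply, Trivialization.linearMapAt_apply,
    if_pos (by simpa using hp), hom_trivializationAt_apply, ContinuousLinearMap.inCoordinates]
  simp only [ContinuousLinearMap.comp_apply]
  rw [Trivialization.continuousLinearMapAt_apply, Trivialization.linearMapAt_apply,
    if_pos (by simp)]
  rfl

theorem contMDiffAt_metricRep (g : TangentMetric E M) {x p : M}
    (hp : p ∈ (chartAt E x).source) :
    ContMDiffAt 𝓘(ℝ, E) 𝓘(ℝ, E →L[ℝ] E →L[ℝ] ℝ) ∞ (metricRep g x) p := by
  have h := (Trivialization.contMDiffAt_section_iff (IB := 𝓘(ℝ, E)) (n := ∞) (s := g.inner)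
    (e := trivializationAt (E →L[ℝ] E →L[ℝ] ℝ) _ x) (x₀ := p) (by simpa using hp)).1
    (g.contMDiff p)
  refine h.congr_of_eventuallyEq ?_
  filter_upwards [(chartAt E x).open_source.mem_nhds hp] with q hq
  ext v w
  exact (hom_trivializationAt_apply_tangent hq (metricAt g q) v w).symm

/-- The vector field `W` in the coordinates of the preferred chart at `x`. -/
def coordRep (x : M) (W : M → E) (p : M) : E := tangentTo x p (W p)

theorem coordRep_self (x : M) (W : M → E) : coordRep x W x = W x := tangentTo_self x (W x)

/-- The vector field `W`, given at each point by its coordinates in the preferred chart there, is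
differentiable at `x`. -/
def DifferentiableFieldAt (W : M → E) (x : M) : Prop :=
  MDifferentiableAt 𝓘(ℝ, E) (𝓘(ℝ, E).prod 𝓘(ℝ, E))
    (fun p => (⟨p, W p⟩ : TangentBundle 𝓘(ℝ, E) M)) x

theorem tangentTo_apply {x p : M} (hp : p ∈ (chartAt E x).source) (v : E) :
    tangentTo x p v = (trivializationAt E (TangentSpace 𝓘(ℝ, E)) x ⟨p, v⟩).2 := by
  have h := (trivializationAt E (TangentSpace 𝓘(ℝ, E)) x).coe_linearMapAt_of_mem (R := ℝ)
    (b := p) (by simpa using hp)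
  exact congrFun h v

theorem differentiableFieldAt_iff {x : M} {W : M → E} :
    DifferentiableFieldAt W x ↔ MDifferentiableAt 𝓘(ℝ, E) 𝓘(ℝ, E) (coordRep x W) x := by
  refine (mdifferentiableAt_section (F := E) (E := (TangentSpace 𝓘(ℝ, E) : M → Type))
    (IB := 𝓘(ℝ, E)) W).trans ?_
  apply Filter.EventuallyEq.mdifferentiableAt_iff
  filter_upwards [(chartAt E x).open_source.mem_nhds (mem_chart_source E x)] with p hp
  exact (tangentTo_apply hp (W p)).symm

/-- The derivative at `x` of a function with values in a normed space. -/
def derivAt {F : Type} [NormedAddCommGroup F] [NormedSpace ℝ F] (f : M → F) (x : M) : E →L[ℝ] F :=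
  mvfderiv 𝓘(ℝ, E) f x

/-- The derivative of the metric at `x` in the preferred chart. -/
def metricDeriv (g : TangentMetric E M) (x : M) : E →L[ℝ] E →L[ℝ] E →L[ℝ] ℝ :=
  derivAt (metricRep g x) x

/-! ### Derivatives of vector-valued functions read in the preferred chart -/

section DerivAt

variable {F : Type} [NormedAddCommGroup F] [NormedSpace ℝ F] {f f' : M → F} {x : M}

theorem hasFDerivAt_comp_chartAt_symm (hf : MDifferentiableAt 𝓘(ℝ, E) 𝓘(ℝ, F) f x) :
    HasFDerivAt (f ∘ (chartAt E x).symm) (derivAt f x) (chartAt E x x) := by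
  have h := hf.mdifferentiableWithinAt (s := Set.univ)
    |>.differentiableWithinAt_comp_extChartAt_symm
  have h1 : DifferentiableAt ℝ (f ∘ (chartAt E x).symm) (chartAt E x x) := by
    simpa [differentiableWithinAt_univ] using h
  convert h1.hasFDerivAt using 1
  ext v
  change mfderiv 𝓘(ℝ, E) 𝓘(ℝ, F) f x v = _
  rw [hf.mfderiv]
  simp [writtenInExtChartAt, fderivWithin_univ, chartAt_self_eq]
  rfl

theorem mdifferentiableAt_of_comp_chartAt_symm
    (hf : DifferentiableAt ℝ (f ∘ (chartAt E x).symm) (chartAt E x x)) :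
    MDifferentiableAt 𝓘(ℝ, E) 𝓘(ℝ, F) f x := by
  have := IsManifold.of_le (I := 𝓘(ℝ, E)) (M := M) (m := 1) (n := ω) le_top
  rw [← mdifferentiableWithinAt_univ]
  apply DifferentiableWithinAt.mdifferentiableWithinAt_of_comp_extChartAt_symm
  simpa [differentiableWithinAt_univ] using hf

theorem derivAt_eq_of_hasFDerivAt {L : E →L[ℝ] F}
    (h : HasFDerivAt (f ∘ (chartAt E x).symm) L (chartAt E x x)) : derivAt f x = L :=
  (hasFDerivAt_comp_chartAt_symm
    (mdifferentiableAt_of_comp_chartAt_symm h.differentiableAt)).unique h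

theorem derivAt_congr (h : f =ᶠ[𝓝 x] f') : derivAt f x = (derivAt f' x : E →L[ℝ] F) := by
  have h1 := Filter.EventuallyEq.mfderiv_eq (I := 𝓘(ℝ, E)) (I' := 𝓘(ℝ, F)) h
  ext v
  exact congrArg (fun A : E →L[ℝ] F => A v) h1

end DerivAt

/-- The derivative of a vector field at `x` in the preferred chart. -/
def coordDeriv (x : M) (W : M → E) : E →L[ℝ] E := derivAt (coordRep x W) x

theorem hasFDerivAt_coordRep {x : M} {W : M → E} (hW : DifferentiableFieldAt W x) :
    HasFDerivAt (fun y => coordRep x W ((chartAt E x).symm y)) (coordDeriv x W)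
      (chartAt E x x) :=
  hasFDerivAt_comp_chartAt_symm (differentiableFieldAt_iff.1 hW)

theorem hasFDerivAt_metricRep (g : TangentMetric E M) (x : M) :
    HasFDerivAt (fun y => metricRep g x ((chartAt E x).symm y)) (metricDeriv g x)
      (chartAt E x x) :=
  hasFDerivAt_comp_chartAt_symm
    ((contMDiffAt_metricRep g (mem_chart_source E x)).mdifferentiableAt (by simp))

theorem coordDeriv_add {x : M} {V W : M → E} (hV : DifferentiableFieldAt V x)
    (hW : DifferentiableFieldAt W x) :
    coordDeriv x (V + W) = coordDeriv x V + coordDeriv x W := by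
  apply derivAt_eq_of_hasFDerivAt
  refine ((hasFDerivAt_coordRep hV).add (hasFDerivAt_coordRep hW)).congr_of_eventuallyEq ?_
  filter_upwards with y
  exact map_add (tangentTo x _) (V _) (W _)

theorem coordDeriv_smul {x : M} {f : M → ℝ} {W : M → E}
    (hf : MDifferentiableAt 𝓘(ℝ, E) 𝓘(ℝ, ℝ) f x) (hW : DifferentiableFieldAt W x) (v : E) :
    coordDeriv x (f • W) v = f x • coordDeriv x W v + derivAt f x v • W x := by
  have h := (hasFDerivAt_comp_chartAt_symm hf).smul (hasFDerivAt_coordRep hW)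
  have h2 := derivAt_eq_of_hasFDerivAt (f := coordRep x (f • W)) (h.congr_of_eventuallyEq
    (Filter.Eventually.of_forall fun y => map_smul (tangentTo x _) (f _) (W _)))
  rw [coordDeriv, h2]
  simp [coordRep_self]

theorem metricDeriv_symm (g : TangentMetric E M) (x : M) (u v w : E) :
    metricDeriv g x u v w = metricDeriv g x u w v := by
  have h := hasFDerivAt_metricRep g x
  have h1 := ((h.clm_apply (hasFDerivAt_const v _)).clm_apply (hasFDerivAt_const w _))
  have h2 := ((h.clm_apply (hasFDerivAt_const w _)).clm_apply (hasFDerivAt_const v _))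
  have h3 := h1.unique (h2.congr_of_eventuallyEq
    (Filter.Eventually.of_forall fun y => metricAt_symm g _ _ _))
  simpa using DFunLike.congr_fun h3 u

/-- Product rule in the chart at `x`: `metricRep` paired with the coordinate expressions of the
fields is the same function near `x`. -/
theorem derivAt_metric (g : TangentMetric E M) {x : M} {V W : M → E}
    (hV : DifferentiableFieldAt V x) (hW : DifferentiableFieldAt W x) (u : E) :
    derivAt (fun p => metricAt g p (V p) (W p)) x u =
      metricDeriv g x u (V x) (W x) + metricAt g x (coordDeriv x V u) (W x) +
        metricAt g x (V x) (coordDeriv x W u) := by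
  have h := ((hasFDerivAt_metricRep g x).clm_apply (hasFDerivAt_coordRep hV)).clm_apply
    (hasFDerivAt_coordRep hW)
  have h2 := derivAt_eq_of_hasFDerivAt
    (f := fun p => metricRep g x p (coordRep x V p) (coordRep x W p)) h
  have h3 : (fun p => metricAt g p (V p) (W p)) =ᶠ[𝓝 x]
      fun p => metricRep g x p (coordRep x V p) (coordRep x W p) := by
    filter_upwards [(chartAt E x).open_source.mem_nhds (mem_chart_source E x)] with p hp
    exact (metricRep_tangentTo g hp _ _).symm
  rw [derivAt_congr h3, h2]
  simp [coordRep_self, metricRep_self]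
  ring

/-- The vector field `W` on `M` pulled back to `E` by the inverse of the preferred chart at `x`. -/
def pullField (x : M) (W : ∀ p : M, TangentSpace 𝓘(ℝ, E) p) (y : E) : E :=
  VectorField.mpullbackWithin 𝓘(ℝ, E) 𝓘(ℝ, E) (extChartAt 𝓘(ℝ, E) x).symm W
    (Set.range 𝓘(ℝ, E)) y

theorem mlieBracket_eq_lieBracket (x : M) (V W : ∀ p : M, TangentSpace 𝓘(ℝ, E) p) :
    VectorField.mlieBracket 𝓘(ℝ, E) V W x =
      VectorField.lieBracket ℝ (pullField x V) (pullField x W) (chartAt E x x) := by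
  rw [← VectorField.mlieBracketWithin_univ, VectorField.mlieBracketWithin_apply,
    mfderiv_extChartAt_self]
  have hset : (extChartAt 𝓘(ℝ, E) x).symm ⁻¹' Set.univ ∩ Set.range 𝓘(ℝ, E) = Set.univ := by simp
  have hx : extChartAt 𝓘(ℝ, E) x x = chartAt E x x := by simp
  rw [hset, hx]
  refine (DFunLike.congr_fun (ContinuousLinearMap.inverse_id (R := ℝ) (M := E)) _).trans ?_
  exact congrFun VectorField.lieBracketWithin_univ _

/-- The pullback applies the inverse of the derivative of the inverse chart. That derivative is
`tangentSymm`, with inverse `tangentTo`, so the manifold bracket reduces to the flat one of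
coordinate fields. -/
theorem pullField_eventuallyEq (x : M) (W : M → E) :
    pullField x W =ᶠ[𝓝 (chartAt E x x)] fun y => coordRep x W ((chartAt E x).symm y) := by
  filter_upwards [(chartAt E x).open_target.mem_nhds (mem_chart_target E x)] with y hy
  have hp : (chartAt E x).symm y ∈ (chartAt E x).source := (chartAt E x).map_target hy
  have h := TangentBundle.symmL_trivializationAt (I := 𝓘(ℝ, E)) hp
  have hy' : extChartAt 𝓘(ℝ, E) x ((chartAt E x).symm y) = y := by
    simpa using (chartAt E x).right_inv hy
  rw [hy'] at h
  have h1 : (tangentSymm x ((chartAt E x).symm y)).inverse =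
      tangentTo x ((chartAt E x).symm y) :=
    ContinuousLinearMap.inverse_eq
      (ContinuousLinearMap.ext fun v => tangentSymm_tangentTo (x := x) hp v)
      (ContinuousLinearMap.ext fun v => tangentTo_tangentSymm (x := x) hp v)
  have h2 : pullField x W y = (tangentSymm x ((chartAt E x).symm y)).inverse
      (W ((chartAt E x).symm y)) := by
    have h3 := congrArg ContinuousLinearMap.inverse h
    exact (DFunLike.congr_fun h3 (W ((chartAt E x).symm y))).symm
  rw [h2, h1, coordRep]

theorem mlieBracket_eq {x : M} {V W : M → E} (hV : DifferentiableFieldAt V x)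
    (hW : DifferentiableFieldAt W x) :
    VectorField.mlieBracket 𝓘(ℝ, E) (M := M) V W x =
      coordDeriv x W (V x) - coordDeriv x V (W x) := by
  refine (mlieBracket_eq_lieBracket x V W).trans ?_
  have e1 := pullField_eventuallyEq x V
  have e2 := pullField_eventuallyEq x W
  have d1 := ((hasFDerivAt_coordRep hV).congr_of_eventuallyEq e1).fderiv
  have d2 := ((hasFDerivAt_coordRep hW).congr_of_eventuallyEq e2).fderiv
  have s1 := e1.self_of_nhds
  have s2 := e2.self_of_nhds
  simp only at s1 s2
  rw [(chartAt E x).left_inv (mem_chart_source E x), coordRep_self] at s1 s2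
  rw [VectorField.lieBracket, d1, d2, s1, s2]

variable [FiniteDimensional ℝ E]

/-- The Christoffel symbols of `g` at `x` in the preferred chart. -/
def christoffelAt (g : TangentMetric E M) (x : M) : E →L[ℝ] E →L[ℝ] E :=
  christoffel (metricAt g x) (metricDeriv g x)

/-- The covariant derivative `∇ᵤ W = d W (u) + Γ (u, W)`, computed at each point in the preferred
chart. -/
def covDeriv (g : TangentMetric E M) (W : M → E) (x : M) : E →L[ℝ] E :=
  coordDeriv x W + (christoffelAt g x).flip (W x)

theorem covDeriv_apply (g : TangentMetric E M) (W : M → E) (x : M) (u : E) :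
    covDeriv g W x u = coordDeriv x W u + christoffelAt g x u (W x) := rfl

theorem covDeriv_add (g : TangentMetric E M) {V W : M → E} {x : M}
    (hV : DifferentiableFieldAt V x) (hW : DifferentiableFieldAt W x) :
    covDeriv g (V + W) x = covDeriv g V x + covDeriv g W x := by
  ext u
  rw [add_apply, covDeriv_apply, covDeriv_apply, covDeriv_apply,
    coordDeriv_add hV hW, Pi.add_apply, map_add, add_apply]
  abel

theorem covDeriv_smul (g : TangentMetric E M) {f : M → ℝ} {W : M → E} {x : M}
    (hf : MDifferentiableAt 𝓘(ℝ, E) 𝓘(ℝ, ℝ) f x) (hW : DifferentiableFieldAt W x) :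
    covDeriv g (f • W) x = f x • covDeriv g W x + (derivAt f x).smulRight (W x) := by
  ext u
  simp only [add_apply, smul_apply,
    ContinuousLinearMap.smulRight_apply]
  rw [covDeriv_apply, covDeriv_apply, coordDeriv_smul hf hW, Pi.smul_apply', map_smul, smul_add]
  abel

theorem derivAt_metric_eq_covDeriv (g : TangentMetric E M) {x : M} {V W : M → E}
    (hV : DifferentiableFieldAt V x) (hW : DifferentiableFieldAt W x) (u : E) :
    derivAt (fun p => metricAt g p (V p) (W p)) x u =
      metricAt g x (covDeriv g V x u) (W x) + metricAt g x (V x) (covDeriv g W x u) := by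
  rw [derivAt_metric g hV hW, ← inner_christoffel_add (metricAt_pos g x) (metricAt_symm g x)
    (metricDeriv_symm g x), covDeriv_apply, covDeriv_apply, christoffelAt, map_add, map_add,
    add_apply]
  abel

theorem covDeriv_sub_covDeriv (g : TangentMetric E M) {x : M} {V W : M → E}
    (hV : DifferentiableFieldAt V x) (hW : DifferentiableFieldAt W x) :
    covDeriv g W x (V x) - covDeriv g V x (W x) =
      VectorField.mlieBracket 𝓘(ℝ, E) (M := M) V W x := by
  refine Eq.trans ?_ (mlieBracket_eq hV hW).symm
  rw [covDeriv_apply, covDeriv_apply, christoffelAt,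
    christoffel_comm _ (metricDeriv_symm g x) (V x)]
  abel

/-- The Levi-Civita connection of `g`. -/
def leviCivita (g : TangentMetric E M) :
    CovariantDerivative 𝓘(ℝ, E) E (fun x : M => TangentSpace 𝓘(ℝ, E) x) where
  toFun W x := (covDeriv (E := E) g W x : E →L[ℝ] E)
  isCovariantDerivativeOnUniv :=
    { add := fun hV hW _ => covDeriv_add (E := E) g hV hW
      leibniz := fun hW hf _ => covDeriv_smul (E := E) g hf hW }

theorem leviCivita_torsion (g : TangentMetric E M) : (leviCivita g).torsion = 0 := by
  rw [CovariantDerivative.torsion_eq_zero_iff]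
  intro V W x hV hW
  exact covDeriv_sub_covDeriv (E := E) g hV hW

end LeviCivita

/-! ### The Levi-Civita connection on `𝒪(-n)`: existence and uniqueness -/

section OMinus
variable {n : ℕ}

theorem isLeviCivita_leviCivita (g : Metric n) : IsLeviCivita g (leviCivita g) := by
  refine ⟨leviCivita_torsion g, ?_⟩
  let : RiemannianBundle (fun x : OMinus n => TangentSpace 𝓘(ℝ, Cn n) x) := ⟨g.toRiemannianMetric⟩
  rw [CovariantDerivative.isMetricCompatible_iff]
  intro x X V W _ hV hW
  exact derivAt_metric_eq_covDeriv (E := Cn n) g hV hW (X x)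

theorem IsLeviCivita.sub_eq_mlieBracket {g : Metric n} {nabla : Connection n}
    (h : IsLeviCivita g nabla) {V W : ∀ p : OMinus n, TangentSpace 𝓘(ℝ, Cn n) p} {x : OMinus n}
    (hV : DifferentiableFieldAt (E := Cn n) V x) (hW : DifferentiableFieldAt (E := Cn n) W x) :
    nabla W x (V x) - nabla V x (W x) = VectorField.mlieBracket 𝓘(ℝ, Cn n) V W x :=
  (CovariantDerivative.torsion_eq_zero_iff nabla).1 h.1 hV hW

theorem IsLeviCivita.derivAt_metric {g : Metric n} {nabla : Connection n}
    (h : IsLeviCivita g nabla) {V W : ∀ p : OMinus n, TangentSpace 𝓘(ℝ, Cn n) p} {x : OMinus n}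
    (hV : DifferentiableFieldAt (E := Cn n) V x) (hW : DifferentiableFieldAt (E := Cn n) W x)
    (u : TangentSpace 𝓘(ℝ, Cn n) x) :
    derivAt (E := Cn n) (fun p => metricAt g p (V p) (W p)) x u =
      metricAt g x (nabla V x u) (W x) + metricAt g x (V x) (nabla W x u) := by
  let : RiemannianBundle (fun x : OMinus n => TangentSpace 𝓘(ℝ, Cn n) x) := ⟨g.toRiemannianMetric⟩
  -- Metric compatibility is applied with a vector field as direction; the local extension of `u`
  -- serves.
  have hu := FiberBundle.extend_apply_self (F := Cn n) u
  have h2 := CovariantDerivative.IsMetricCompatible.mvfderiv_inner_eq (cov := nabla) h.2 (x := x)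
    (FiberBundle.extend (Cn n) u) (σ := V) (τ := W) hV hW
  simp only [hu] at h2
  exact h2

/-- On extensions of tangent vectors at `x`, each connection yields a family of symbols at `x`;
their torsion and their effect on `g` agree, so `eq_of_torsion_eq_of_metric_eq` applies. -/
theorem IsLeviCivita.apply_extend_eq {g : Metric n} {nabla nabla' : Connection n}
    (h : IsLeviCivita g nabla) (h' : IsLeviCivita g nabla') (x : OMinus n)
    (v : TangentSpace 𝓘(ℝ, Cn n) x) :
    nabla (FiberBundle.extend (Cn n) v) x = nabla' (FiberBundle.extend (Cn n) v) x := by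
  let e : Cn n → (∀ p : OMinus n, TangentSpace 𝓘(ℝ, Cn n) p) := fun v =>
    FiberBundle.extend (Cn n) (show TangentSpace 𝓘(ℝ, Cn n) x from v)
  have hd : ∀ v, DifferentiableFieldAt (E := Cn n) (e v) x := fun v =>
    FiberBundle.mdifferentiableAt_extend ..
  have he : ∀ v, e v x = v := fun v => FiberBundle.extend_apply_self (F := Cn n) _
  have hA := eq_of_torsion_eq_of_metric_eq (metricAt_pos g x) (metricAt_symm g x)
    (a := fun u v => nabla (e v) x u) (b := fun u v => nabla' (e v) x u)
    (fun u v => by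
      have h1 := h.sub_eq_mlieBracket (hd u) (hd v)
      have h2 := h'.sub_eq_mlieBracket (hd u) (hd v)
      rw [he, he] at h1 h2
      exact h1.trans h2.symm)
    (fun u v w => by
      have h1 := h.derivAt_metric (hd v) (hd w) u
      have h2 := h'.derivAt_metric (hd v) (hd w) u
      rw [he, he] at h1 h2
      exact h1.symm.trans h2)
  exact ContinuousLinearMap.ext fun u => congrFun (congrFun hA u) v

/-- The Levi-Civita connection is unique. -/
theorem IsLeviCivita.apply_eq {g : Metric n} {nabla nabla' : Connection n}
    (h : IsLeviCivita g nabla) (h' : IsLeviCivita g nabla')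
    {W : ∀ p : OMinus n, TangentSpace 𝓘(ℝ, Cn n) p} {x : OMinus n}
    (hW : DifferentiableFieldAt (E := Cn n) W x) :
    nabla W x = nabla' W x := by
  -- The difference of two connections is tensorial, so `W` may be replaced by the extension of its
  -- value at `x`.
  have h1 := IsCovariantDerivativeOn.difference_apply nabla.isCovariantDerivativeOnUniv
    nabla'.isCovariantDerivativeOnUniv (Set.mem_univ x) hW
  have h2 := IsCovariantDerivativeOn.difference_apply nabla.isCovariantDerivativeOnUniv
    nabla'.isCovariantDerivativeOnUniv (Set.mem_univ x)
    (FiberBundle.mdifferentiableAt_extend 𝓘(ℝ, Cn n) (Cn n) (W x))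
  rw [FiberBundle.extend_apply_self, h1, h.apply_extend_eq h', sub_self] at h2
  exact sub_eq_zero.1 h2

end OMinus

/-! ### Derivatives in charts -/

section Charts

variable {𝕜 : Type} [NontriviallyNormedField 𝕜] {E : Type} [NormedAddCommGroup E]
  [NormedSpace 𝕜 E] {M N : Type} [TopologicalSpace M] [ChartedSpace E M]
  [TopologicalSpace N] [ChartedSpace E N]

/-- Both tangent spaces are modelled on the preferred charts, so the manifold derivative is the
ordinary derivative of the expression in exactly these charts. -/
theorem hasMFDerivAt_of_charts {f : M → N} {x : M} {F : E → E} {F' : E →L[𝕜] E}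
    (hf : ContinuousAt f x)
    (hF : ∀ᶠ y in 𝓝 (chartAt E x x), chartAt E (f x) (f ((chartAt E x).symm y)) = F y)
    (hF' : HasFDerivAt F F' (chartAt E x x)) :
    HasMFDerivAt 𝓘(𝕜, E) 𝓘(𝕜, E) f x F' := by
  refine ⟨hf, ?_⟩
  have h : HasFDerivAt (fun y => chartAt E (f x) (f ((chartAt E x).symm y))) F' (chartAt E x x) :=
    hF'.congr_of_eventuallyEq hF
  simp only [writtenInExtChartAt, Function.comp_def, extChartAt, OpenPartialHomeomorph.extend,
    modelWithCornersSelf_partialEquiv, PartialEquiv.trans_refl, modelWithCornersSelf_coe,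
    Set.range_id]
  exact h.hasFDerivWithinAt (s := Set.univ)

theorem mfderiv_eq_of_charts {f : M → N} {x : M} {F : E → E} {F' : E →L[𝕜] E}
    (hf : ContinuousAt f x)
    (hF : ∀ᶠ y in 𝓝 (chartAt E x x), chartAt E (f x) (f ((chartAt E x).symm y)) = F y)
    (hF' : HasFDerivAt F F' (chartAt E x x)) (v : E) :
    mfderiv 𝓘(𝕜, E) 𝓘(𝕜, E) f x v = F' v := by
  rw [(hasMFDerivAt_of_charts hf hF hF').mfderiv]
  rfl

theorem chartAt_opens_symm {U : TopologicalSpace.Opens M} (p : U) :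
    ∀ᶠ y in 𝓝 (chartAt E p p), ((chartAt E p).symm y : M) = (chartAt E (p : M)).symm y := by
  filter_upwards [(chartAt E p).open_target.mem_nhds (mem_chart_target E p)] with y hy
  exact (chartAt E (p : M)).subtypeRestr_symm_apply ⟨p⟩ hy

theorem mfderiv_val_opens {U : TopologicalSpace.Opens M} (p : U) (v : E) :
    mfderiv 𝓘(𝕜, E) 𝓘(𝕜, E) (Subtype.val : U → M) p v = v := by
  refine mfderiv_eq_of_charts continuous_subtype_val.continuousAt
    (F := id) ?_ (hasFDerivAt_id _) v
  filter_upwards [chartAt_opens_symm (E := E) p,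
    (chartAt E p).open_target.mem_nhds (mem_chart_target E p)] with y hy hy'
  exact (chartAt E p).right_inv hy'

end Charts

/-! ### The tangent trivialisation as the derivative of a transition map -/

section ChartsReal

variable {E : Type} [NormedAddCommGroup E] [NormedSpace ℝ E]
  {M : Type} [TopologicalSpace M] [ChartedSpace E M] [IsManifold 𝓘(ℝ, E) ω M]

theorem tangentSymm_eq_fderiv {x p : M} (hp : p ∈ (chartAt E x).source) :
    tangentSymm x p = fderiv ℝ (fun y => chartAt E p ((chartAt E x).symm y)) (chartAt E x p) := by
  have h := TangentBundle.symmL_trivializationAt_eq_core (I := 𝓘(ℝ, E)) hp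
  have h2 := tangentBundleCore_coordChange_achart (I := 𝓘(ℝ, E)) x p p
  refine (h.trans h2).trans ?_
  simp [fderivWithin_univ, Function.comp_def]
  rfl

end ChartsReal

/-! ### Algebra of the form `dz¹ ∧ … ∧ dzⁿ` -/

section DzForm

variable {n : ℕ}

theorem dzForm_smul (ζ : ℂ) (v : Fin n → Cn n) :
    dzForm n (fun j => ζ • v j) = ζ ^ n * dzForm n v := by
  have := (dzForm n).map_smul_univ (fun _ => ζ) v
  simpa using this

theorem dzForm_vecMul (B : Matrix (Fin n) (Fin n) ℂ) (v w : Fin n → Cn n)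
    (h : ∀ j k, w j k = ∑ l, v j l * B l k) : dzForm n w = dzForm n v * B.det := by
  rw [dzForm_apply, dzForm_apply, ← Matrix.det_mul]
  congr 1
  ext j k
  simp [Matrix.mul_apply, h]

/-- Cramer's rule. -/
theorem sum_mul_dzForm_update (α : Cn n →ₗ[ℂ] ℂ) (x : Cn n) (W : Fin n → Cn n) :
    ∑ j, dzForm n (Function.update W j (α (W j) • x)) = α x * dzForm n W := by
  have h1 : ∀ j, dzForm n (Function.update W j (α (W j) • x)) =
      α (W j) * dzForm n (Function.update W j x) := fun j => by
    simp
  have h2 : ∑ j, dzForm n (Function.update W j x) • W j = dzForm n W • x := by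
    -- Cramer's rule for the matrix with columns `W j` and right-hand side `x`. Applying `α` then
    -- expresses that the rank-one endomorphism `w ↦ α(w) x` has trace `α x`.
    have := Matrix.mulVec_cramer (Matrix.of fun j k => W j k).transpose (fun k => x k)
    ext k
    have hk := congrFun this k
    rw [Matrix.det_transpose] at hk
    simp only [Matrix.mulVec, dotProduct, Matrix.cramer_apply, Pi.smul_apply, smul_eq_mul,
      Matrix.transpose_apply, Matrix.of_apply] at hk
    rw [PiLp.smul_apply, smul_eq_mul, dzForm_apply, ← hk]
    simp only [WithLp.ofLp_sum, Finset.sum_apply, PiLp.smul_apply, smul_eq_mul]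
    refine Finset.sum_congr rfl fun j _ => ?_
    rw [mul_comm, dzForm_apply, ← Matrix.det_transpose]
    congr 2
    ext a b
    by_cases hb : b = j
    · subst hb; simp
    · simp [hb]
  have h3 := congrArg α h2
  simp only [map_sum, map_smul, smul_eq_mul] at h3
  rw [mul_comm (α x), ← h3]
  refine Finset.sum_congr rfl fun j _ => ?_
  rw [h1, mul_comm]

theorem sum_dzForm_update_smul (c : ℂ) (W : Fin n → Cn n) :
    ∑ j, dzForm n (Function.update W j (c • W j)) = n * c * dzForm n W := by
  have h1 : ∀ j, dzForm n (Function.update W j (c • W j)) = c * dzForm n W := fun j => by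
    simp
  simp [h1]
  ring

end DzForm

/-! ### The covering map in the standard charts -/

section Psi

variable {n : ℕ}

/-- The expression `z ↦ (z¹ / zⁱ, …, (zⁱ)ⁿ, …, zⁿ / zⁱ)` of `cover` in the chart over
`{ξⁱ ≠ 0}`. -/
def coverChart (i : Fin n) (z : Cn n) : Cn n :=
  WithLp.toLp 2 (fun k => if k = i then z i ^ n else z k / z i)

theorem coverChart_apply (i k : Fin n) (z : Cn n) :
    coverChart i z k = if k = i then z i ^ n else z k / z i := rfl

theorem chart_cover (i : Fin n) (z : punctured n) : chart i (cover n z) = coverChart i z := by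
  ext k
  change (if k = i then 1 * (z : Cn n) i ^ n else ratio i k (Projectivization.mk ℂ _ _)) = _
  rw [coverChart_apply, one_mul, ratio_mk]

theorem cover_mem_chart_source_iff (i : Fin n) (z : punctured n) :
    cover n z ∈ (chart i).source ↔ (z : Cn n) i ≠ 0 :=
  rep_mk_ne_zero_iff i _ _

theorem contDiffAt_coverChart {i : Fin n} {z : Cn n} (hz : z i ≠ 0) :
    ContDiffAt ℂ ω (coverChart i) z := by
  rw [contDiffAt_piLp]
  intro k
  by_cases hk : k = i
  · have : (fun z => coverChart i z k) = fun z : Cn n => z i ^ n := by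
      ext z; simp [coverChart_apply, hk]
    rw [this]
    fun_prop
  · have : (fun z => coverChart i z k) = fun z : Cn n => z k / z i := by
      ext z; simp [coverChart_apply, hk]
    rw [this]
    exact ContDiffAt.div (by fun_prop) (by fun_prop) hz

/-- The complex derivative of `coverChart`. -/
def coverDeriv (i : Fin n) (z : Cn n) : Cn n →L[ℂ] Cn n := fderiv ℂ (coverChart i) z

theorem hasFDerivAt_coverChart {i : Fin n} {z : Cn n} (hz : z i ≠ 0) :
    HasFDerivAt (coverChart i) (coverDeriv i z) z :=
  ((contDiffAt_coverChart hz).differentiableAt (by simp)).hasFDerivAt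

theorem hasFDerivAt_coord (k : Fin n) (z : Cn n) :
    HasFDerivAt (fun z : Cn n => z k) (EuclideanSpace.proj k : Cn n →L[ℂ] ℂ) z :=
  (EuclideanSpace.proj k : Cn n →L[ℂ] ℂ).hasFDerivAt

theorem coverDeriv_apply_self {i : Fin n} {z : Cn n} (hz : z i ≠ 0) (v : Cn n) :
    coverDeriv i z v i = n * z i ^ (n - 1) * v i := by
  have h1 := (hasFDerivAt_coord i (coverChart i z)).comp z (hasFDerivAt_coverChart hz)
  have h2 := (hasFDerivAt_coord i z).pow n
  have h3 : ((fun z : Cn n => z i) ∘ coverChart i) = fun z : Cn n => z i ^ n := by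
    ext z; simp [coverChart_apply]
  rw [h3] at h1
  simpa [mul_assoc] using DFunLike.congr_fun (h1.unique h2) v

theorem coverDeriv_apply_of_ne {i k : Fin n} (hk : k ≠ i) {z : Cn n} (hz : z i ≠ 0) (v : Cn n) :
    coverDeriv i z v k = v k / z i - z k * v i / z i ^ 2 := by
  have h1 := (hasFDerivAt_coord k (coverChart i z)).comp z (hasFDerivAt_coverChart hz)
  have h2 := (hasFDerivAt_coord k z).mul
    ((hasDerivAt_inv hz).comp_hasFDerivAt z (hasFDerivAt_coord i z))
  have h3 : ((fun z : Cn n => z k) ∘ coverChart i) =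
      (fun z : Cn n => z k) * (fun t : ℂ => t⁻¹) ∘ fun z : Cn n => z i := by
    ext z; simp [coverChart_apply, hk, div_eq_mul_inv]
  rw [h3] at h1
  have := DFunLike.congr_fun (h1.unique h2) v
  simp at this
  rw [this]
  field_simp
  ring

/-- The diagonal contributes `n (zⁱ)ⁿ⁻¹` once and `(zⁱ)⁻¹` with multiplicity `n - 1`; the powers of
`zⁱ` cancel, which is what singles out the bundle `𝒪(-n)`. -/
theorem dzForm_coverDeriv {i : Fin n} {z : Cn n} (hz : z i ≠ 0) (v : Fin n → Cn n) :
    dzForm n (fun j => coverDeriv i z (v j)) = n * dzForm n v := by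
  have hn : 0 < n := i.pos
  -- The derivative, acting on row vectors, is a rank-one perturbation of the identity followed by a
  -- diagonal matrix. The perturbation has determinant 1 since `r i = 0`.
  let r : Fin n → ℂ := fun k => if k = i then 0 else -z k / z i
  let d : Fin n → ℂ := fun k => if k = i then n * z i ^ (n - 1) else (z i)⁻¹
  let B : Matrix (Fin n) (Fin n) ℂ :=
    (1 + Matrix.vecMulVec (Pi.single i 1) r) * Matrix.diagonal d
  have hB : B.det = n := by
    have h1 : (1 + Matrix.vecMulVec (Pi.single i 1) r).det = 1 := by
      rw [Matrix.vecMulVec_eq Unit, Matrix.det_one_add_replicateCol_mul_replicateRow]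
      simp [r]
    have h2 : ∏ k, d k = n := by
      rw [← Finset.mul_prod_erase _ _ (Finset.mem_univ i)]
      have : ∏ k ∈ Finset.univ.erase i, d k = ∏ k ∈ Finset.univ.erase i, (z i)⁻¹ :=
        Finset.prod_congr rfl fun k hk => by simp [d, Finset.ne_of_mem_erase hk]
      rw [this, Finset.prod_const, Finset.card_erase_of_mem (Finset.mem_univ i)]
      simp only [d, if_true, Finset.card_univ, Fintype.card_fin, inv_pow]
      field_simp
    simp only [B]
    rw [Matrix.det_mul, h1, Matrix.det_diagonal, h2, one_mul]
  rw [dzForm_vecMul B v _ fun j k => ?_, hB, mul_comm]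
  have hBlk : ∀ l, v j l * B l k = (if l = k then v j l * d k else 0) +
      (if l = i then v j l * r k * d k else 0) := by
    intro l
    simp only [B, Matrix.mul_diagonal, Matrix.add_apply, Matrix.one_apply, Matrix.vecMulVec_apply,
      Pi.single_apply]
    split_ifs <;> ring
  simp only [hBlk, Finset.sum_add_distrib, Finset.sum_ite_eq', Finset.mem_univ, if_true]
  by_cases hk : k = i
  · subst hk
    rw [coverDeriv_apply_self hz]
    simp [d, r]
    ring
  · rw [coverDeriv_apply_of_ne hk hz]
    simp [d, r, hk]
    field_simp
    ring

theorem coverDeriv_surjective {i : Fin n} {z : Cn n} (hz : z i ≠ 0) :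
    Function.Surjective (coverDeriv i z) := by
  have hn : (n : ℂ) ≠ 0 := by exact_mod_cast i.pos.ne'
  intro y
  let c : ℂ := y i / (n * z i ^ (n - 1))
  -- The system is triangular: the `i`-th equation gives `vⁱ = c`, and each other one then gives
  -- `vᵏ`.
  refine ⟨WithLp.toLp 2 fun k => if k = i then c else z i * y k + z k * c / z i, ?_⟩
  ext k
  by_cases hk : k = i
  · subst hk
    rw [coverDeriv_apply_self hz]
    simp [c]
    field_simp
  · rw [coverDeriv_apply_of_ne hk hz]
    simp [hk]
    field_simp
    ring

/-- An `n`-th root of the fibre coordinate fixes `zⁱ`, and the affine coordinates fix the rest. With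
`eq_of_eventually_ne_zero`, identities on a chart need only be checked on the image of `coverChart`.
-/
theorem exists_coverChart_eq {i : Fin n} {y : Cn n} (hy : y i ≠ 0) :
    ∃ z : punctured n, (z : Cn n) i ≠ 0 ∧ coverChart i z = y := by
  obtain ⟨c, hc⟩ := IsAlgClosed.exists_pow_nat_eq (y i) i.pos
  have hc0 : c ≠ 0 := by
    rintro rfl
    rw [zero_pow i.pos.ne'] at hc
    exact hy hc.symm
  let z : Cn n := WithLp.toLp 2 fun k => if k = i then c else y k * c
  have hzi : z i = c := by simp [z]
  have hz : z ≠ 0 := fun h => hc0 (by rw [← hzi, h]; rfl)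
  refine ⟨⟨z, hz⟩, by simpa [hzi] using hc0, ?_⟩
  ext k
  rw [coverChart_apply]
  by_cases hk : k = i
  · subst hk; simp [hzi, hc]
  · simp [hk, z, hc0]

end Psi

/-! ### Transition maps -/

section Transition

variable {n : ℕ}

/-- Two functions that are continuous at `y` and agree off `{yⁱ = 0}` agree at `y`. -/
theorem eq_of_eventually_ne_zero {X : Type} [TopologicalSpace X] [T2Space X] {i : Fin n}
    {f g : Cn n → X} {y : Cn n} (hf : ContinuousAt f y) (hg : ContinuousAt g y)
    (h : ∀ᶠ y' in 𝓝 y, y' i ≠ 0 → f y' = g y') : f y = g y := by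
  -- The `i`-th coordinate is a surjective linear functional, hence open, and preimages of dense
  -- sets under open maps are dense.
  have hd : Dense {y : Cn n | y i ≠ 0} := by
    refine (dense_compl_singleton (0 : ℂ)).preimage
      (f := (EuclideanSpace.proj i : Cn n →L[ℂ] ℂ)) (ContinuousLinearMap.isOpenMap _ fun c => ?_)
    exact ⟨EuclideanSpace.single i c, by simp⟩
  have hne : (𝓝[{y : Cn n | y i ≠ 0}] y).NeBot := mem_closure_iff_nhdsWithin_neBot.1 (hd y)
  refine tendsto_nhds_unique_of_eventuallyEq (l := 𝓝[{y : Cn n | y i ≠ 0}] y)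
    (hf.tendsto.mono_left nhdsWithin_le_nhds) (hg.tendsto.mono_left nhdsWithin_le_nhds) ?_
  filter_upwards [nhdsWithin_le_nhds h, self_mem_nhdsWithin] with y' h1 h2
  exact h1 h2

/-- The change of coordinates from the `i`-th to the `j`-th standard chart. -/
def transition (i j : Fin n) (y : Cn n) : Cn n := chart j ((chart i).symm y)

theorem mem_transition_source_iff (i j : Fin n) (y : Cn n) :
    (chart i).symm y ∈ (chart j).source ↔ affineRep i y j ≠ 0 :=
  rep_mk_ne_zero_iff j _ _

theorem isOpen_affineRep_ne_zero (i j : Fin n) : IsOpen {y : Cn n | affineRep i y j ≠ 0} :=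
  isOpen_ne_fun (contDiff_affineRep i j).continuous continuous_const

theorem contDiffAt_transition {i j : Fin n} {y : Cn n}
    (hy : (chart i).symm y ∈ (chart j).source) : ContDiffAt ℂ ω (transition i j) y := by
  have hs : y ∈ ((chart i).symm ≫ₕ chart j).source := ⟨trivial, hy⟩
  exact (contDiffOn_transition i j).contDiffAt
    (((chart i).symm ≫ₕ chart j).open_source.mem_nhds hs)

theorem transition_coverChart {i : Fin n} (j : Fin n) {z : punctured n} (hz : (z : Cn n) i ≠ 0) :
    transition i j (coverChart i z) = coverChart j z := by
  rw [transition, ← chart_cover, (chart i).left_inv ((cover_mem_chart_source_iff i z).2 hz),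
    chart_cover]

theorem symm_coverChart {i : Fin n} {z : punctured n} (hz : (z : Cn n) i ≠ 0) :
    (chart i).symm (coverChart i z) = cover n z := by
  rw [← chart_cover, (chart i).left_inv ((cover_mem_chart_source_iff i z).2 hz)]

/-- The chain rule applied to `transition_coverChart`, which holds in a neighbourhood of `z`. -/
theorem fderiv_transition_coverDeriv {i j : Fin n} {z : punctured n} (hi : (z : Cn n) i ≠ 0)
    (hj : (z : Cn n) j ≠ 0) (v : Cn n) :
    fderiv ℂ (transition i j) (coverChart i z) (coverDeriv i z v) = coverDeriv j z v := by
  have hs : (chart i).symm (coverChart i z) ∈ (chart j).source := by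
    rw [symm_coverChart hi]
    exact (cover_mem_chart_source_iff j z).2 hj
  have h1 := ((contDiffAt_transition hs).differentiableAt (by simp)).hasFDerivAt.comp (z : Cn n)
    (hasFDerivAt_coverChart hi)
  have h2 : transition i j ∘ coverChart i =ᶠ[𝓝 (z : Cn n)] coverChart j := by
    filter_upwards [(isOpen_compl_singleton (x := (0 : Cn n))).mem_nhds (punctured_ne_zero z),
      (isOpen_ne_fun (f := fun z : Cn n => z i) (by fun_prop) continuous_const).mem_nhds hi]
      with w hw hwi
    exact transition_coverChart j (z := ⟨w, hw⟩) hwi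
  have h3 := (hasFDerivAt_coverChart hj).congr_of_eventuallyEq h2
  exact DFunLike.congr_fun (h1.unique h3) v

/-- Off the zero section the transition map intertwines two maps with the same Jacobian determinant
`n`, so its own is 1; continuity gives the zero section. -/
theorem dzForm_fderiv_transition {i j : Fin n} {y : Cn n}
    (hy : (chart i).symm y ∈ (chart j).source) (v : Fin n → Cn n) :
    dzForm n (fun k => fderiv ℂ (transition i j) y (v k)) = dzForm n v := by
  refine eq_of_eventually_ne_zero (i := i)
    (f := fun y => dzForm n (fun k => fderiv ℂ (transition i j) y (v k)))
    (g := fun _ => dzForm n v) ?_ continuousAt_const ?_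
  · have h1 : ContinuousAt (fderiv ℂ (transition i j)) y :=
      (contDiffAt_transition hy).continuousAt_fderiv (by simp)
    exact (dzForm n).cont.continuousAt.comp
      (continuousAt_pi.2 fun k => h1.clm_apply continuousAt_const)
  · have hop : ∀ᶠ y' in 𝓝 y, affineRep i y' j ≠ 0 :=
      (isOpen_affineRep_ne_zero i j).mem_nhds ((mem_transition_source_iff i j y).1 hy)
    filter_upwards [hop] with y' hy' hyi
    obtain ⟨z, hz, rfl⟩ := exists_coverChart_eq hyi
    rw [← mem_transition_source_iff, symm_coverChart hz, cover_mem_chart_source_iff] at hy'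
    choose w hw using fun k => coverDeriv_surjective hz (v k)
    obtain rfl : (fun k => coverDeriv i z (w k)) = v := funext hw
    simp only [fderiv_transition_coverDeriv hz hy']
    rw [dzForm_coverDeriv hz, dzForm_coverDeriv hy']

end Transition

/-! ### The holomorphic volume forms -/

section Forms

variable {n : ℕ}

/-- The index of the preferred chart at `p`. -/
def chartIndex (p : OMinus n) : Fin n := (exists_rep_ne_zero p).choose

theorem mem_chart_chartIndex_source (p : OMinus n) : p ∈ (chart (chartIndex p)).source :=
  (exists_rep_ne_zero p).choose_spec

/-- The holomorphic volume form of `𝒪(-n)`: it is `n⁻¹ dy¹ ∧ … ∧ dyⁿ` in each standard chart. -/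
def volumeForm (n : ℕ) : TopForm n (OMinus n) := fun _ => (n : ℂ)⁻¹ • dzForm n

theorem dzForm_ne_zero (n : ℕ) : dzForm n ≠ 0 := by
  intro h
  have h1 : dzForm n (fun j => EuclideanSpace.single j 1) = 1 := by
    rw [dzForm_apply]
    convert Matrix.det_one (n := Fin n) (R := ℂ)
    ext j k
    simp [Matrix.one_apply, eq_comm, PiLp.single_apply]
  rw [h] at h1
  simp at h1

theorem volumeForm_ne_zero [NeZero n] (p : OMinus n) : volumeForm n p ≠ 0 := by
  intro h
  have h1 : (n : ℂ)⁻¹ • dzForm n = 0 := h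
  rw [smul_eq_zero] at h1
  rcases h1 with h1 | h1
  · exact NeZero.ne n (by exact_mod_cast inv_eq_zero.1 h1)
  · exact dzForm_ne_zero n h1

/-- Not the identity in general: tangent vectors at the image point are expressed in the preferred
chart there, which need not be the `i`-th. -/
theorem mfderiv_chart_symm (i : Fin n) (y v : Cn n) :
    mfderiv 𝓘(ℂ, Cn n) 𝓘(ℂ, Cn n) (chart i).symm y v =
      fderiv ℂ (transition i (chartIndex ((chart i).symm y))) y v := by
  refine mfderiv_eq_of_charts ?_ (F := transition i (chartIndex ((chart i).symm y))) ?_ ?_ v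
  · exact (chart i).continuousAt_symm trivial
  · exact Filter.Eventually.of_forall fun y' => rfl
  · exact ((contDiffAt_transition (mem_chart_chartIndex_source _)).differentiableAt
      (by simp)).hasFDerivAt

theorem volumeForm_isHolomorphic (n : ℕ) : (volumeForm n).IsHolomorphic := by
  rintro _ ⟨i, rfl⟩
  refine DifferentiableOn.congr (f := fun _ => (n : ℂ)⁻¹ • dzForm n)
    (differentiableOn_const _) fun y _ => ?_
  refine ContinuousAlternatingMap.ext fun v => ?_
  change (n : ℂ)⁻¹ * dzForm n (fun k => mfderiv 𝓘(ℂ, Cn n) 𝓘(ℂ, Cn n) (chart i).symm y (v k)) =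
    (n : ℂ)⁻¹ * dzForm n v
  have e1 : (fun k => mfderiv 𝓘(ℂ, Cn n) 𝓘(ℂ, Cn n) (chart i).symm y (v k)) =
      fun k => fderiv ℂ (transition i (chartIndex ((chart i).symm y))) y (v k) :=
    funext fun k => mfderiv_chart_symm i y (v k)
  exact congrArg ((n : ℂ)⁻¹ * ·) ((congrArg (dzForm n) e1).trans
    (dzForm_fderiv_transition (mem_chart_chartIndex_source _) v))

variable [NeZero n]

/-- The form on `(ℂⁿ ∖ 0) / μₙ` induced by `dz¹ ∧ … ∧ dzⁿ`. -/
def quotientForm (n : ℕ) [NeZero n] : TopForm n (PuncturedQuotient n) := fun _ => dzForm n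

/-- The charts of `(ℂⁿ ∖ 0) / μₙ` are multiplication by a root of unity in the coordinates of
`ℂⁿ ∖ 0`. -/
theorem exists_rootOfUnity_chart {e : OpenPartialHomeomorph (PuncturedQuotient n) (Cn n)}
    (he : e ∈ atlas (Cn n) (PuncturedQuotient n)) {z : punctured n}
    (hz : quotientMap n z ∈ e.source) :
    ∃ ζ : ℂ, ζ ^ n = 1 ∧ ζ • (z : Cn n) ∈ e.target ∧
      ∀ w : punctured n, ζ • (w : Cn n) ∈ e.target → quotientMap n w ∈ e.source ∧
        e (quotientMap n w) = ζ • (w : Cn n) := by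
  obtain ⟨w, hw, h⟩ := (chart_puncturedQuotient he).1 _ (e.map_source hz)
  rw [e.left_inv hz, eq_comm, quotientMap_eq_iff] at h
  obtain ⟨ζ, rfl⟩ := h
  rw [coe_smul] at hw
  refine ⟨((ζ : ℂˣ) : ℂ), ?_, by rw [hw]; exact e.map_source hz, fun x hx => ?_⟩
  · have := (mem_rootsOfUnity n (ζ : ℂˣ)).1 ζ.2
    simpa using congrArg (fun u : ℂˣ => (u : ℂ)) this
  · have hq : quotientMap n x = quotientMap n (ζ • x) := (quotientMap_eq_iff.2 ⟨ζ, rfl⟩).symm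
    have h2 := (chart_puncturedQuotient he).2 (ζ • x) hx
    obtain ⟨x', hx', h3⟩ := (chart_puncturedQuotient he).1 _ hx
    obtain rfl : x' = ζ • x := Subtype.ext hx'
    refine ⟨?_, by rw [hq, h2, coe_smul]⟩
    rw [hq, ← h3]
    exact e.map_target hx

theorem hasFDerivAt_smul (ζ : ℂ) (y : Cn n) :
    HasFDerivAt (fun y : Cn n => ζ • y) (ζ • ContinuousLinearMap.id ℂ (Cn n)) y :=
  (hasFDerivAt_id y).const_smul ζ

/-- The preferred chart and `e` differ locally by multiplication by some `ζ` in `μₙ`, which scales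
an `n`-form by `ζⁿ = 1`. The expression in each chart is therefore constant. -/
theorem quotientForm_isHolomorphic (n : ℕ) [NeZero n] : (quotientForm n).IsHolomorphic := by
  intro e he
  refine DifferentiableOn.congr (f := fun _ => dzForm n) (differentiableOn_const _) fun y hy => ?_
  refine ContinuousAlternatingMap.ext fun v => ?_
  change dzForm n (fun k => mfderiv 𝓘(ℂ, Cn n) 𝓘(ℂ, Cn n) e.symm y (v k)) = dzForm n v
  obtain ⟨z, rfl, hz⟩ := (chart_puncturedQuotient he).1 y hy
  obtain ⟨ζ, hζ, hζz, h⟩ := exists_rootOfUnity_chart (chart_mem_atlas (Cn n) (e.symm (z : Cn n)))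
    (z := z) (by rw [hz]; exact mem_chart_source _ _)
  have hd : ∀ v : Cn n, mfderiv 𝓘(ℂ, Cn n) 𝓘(ℂ, Cn n) e.symm (z : Cn n) v = ζ • v := by
    refine fun v => mfderiv_eq_of_charts (e.continuousAt_symm hy) (F := fun y => ζ • y) ?_
      (hasFDerivAt_smul ζ _) v
    have h1 : ∀ᶠ y in 𝓝 (z : Cn n), ζ • y ∈ (chartAt (Cn n) (e.symm (z : Cn n))).target :=
      (continuous_const_smul ζ).continuousAt.eventually_mem
        ((chartAt (Cn n) (e.symm (z : Cn n))).open_target.mem_nhds hζz)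
    filter_upwards [h1, e.open_target.mem_nhds hy] with y h1 h2
    obtain ⟨w, rfl, hw⟩ := (chart_puncturedQuotient he).1 y h2
    change chartAt (Cn n) (e.symm (z : Cn n)) (e.symm (w : Cn n)) = _
    rw [hw]
    exact (h w h1).2
  have e1 : (fun k => mfderiv 𝓘(ℂ, Cn n) 𝓘(ℂ, Cn n) e.symm (z : Cn n) (v k)) =
    fun k => ζ • v k := funext fun k => hd (v k)
  exact (congrArg (dzForm n) e1).trans ((dzForm_smul ζ v).trans (by rw [hζ, one_mul]))

theorem chartAt_punctured_symm (z : punctured n) :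
    ∀ᶠ y in 𝓝 (z : Cn n), ((chartAt (Cn n) z).symm y : Cn n) = y :=
  chartAt_opens_symm (E := Cn n) z

theorem quotientForm_pullback (n : ℕ) [NeZero n] :
    (quotientForm n).pullback (quotientMap n) =
      (stdForm n).pullback (Subtype.val : punctured n → Cn n) := by
  ext1 z
  refine ContinuousAlternatingMap.ext fun v => ?_
  change dzForm n (fun k => mfderiv 𝓘(ℂ, Cn n) 𝓘(ℂ, Cn n) (quotientMap n) z (v k)) =
    dzForm n (fun k => mfderiv 𝓘(ℂ, Cn n) 𝓘(ℂ, Cn n) (Subtype.val : punctured n → Cn n) z (v k))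
  obtain ⟨ζ, hζ, hζz, h⟩ := exists_rootOfUnity_chart (chart_mem_atlas (Cn n) (quotientMap n z))
    (mem_chart_source _ _)
  have hd : ∀ v : Cn n, mfderiv 𝓘(ℂ, Cn n) 𝓘(ℂ, Cn n) (quotientMap n) z v = ζ • v := by
    refine fun v => mfderiv_eq_of_charts (quotientMap_isLocalHomeomorph n).continuous.continuousAt
      (F := fun y => ζ • y) ?_ (hasFDerivAt_smul ζ _) v
    have h1 : ∀ᶠ y in 𝓝 (z : Cn n), ζ • y ∈ (chartAt (Cn n) (quotientMap n z)).target :=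
      (continuous_const_smul ζ).continuousAt.eventually_mem
        ((chartAt (Cn n) (quotientMap n z)).open_target.mem_nhds hζz)
    filter_upwards [h1, chartAt_punctured_symm z] with y h1 h2
    have := (h ((chartAt (Cn n) z).symm y) (by rw [h2]; exact h1)).2
    rw [this, h2]
  have hv : ∀ v : Cn n,
      mfderiv 𝓘(ℂ, Cn n) 𝓘(ℂ, Cn n) (Subtype.val : punctured n → Cn n) z v = v :=
    mfderiv_val_opens z
  have e1 : (fun k => mfderiv 𝓘(ℂ, Cn n) 𝓘(ℂ, Cn n) (quotientMap n) z (v k)) =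
    fun k => ζ • (show Cn n from v k) := funext fun k => hd (v k)
  have e2 : (fun k => mfderiv 𝓘(ℂ, Cn n) 𝓘(ℂ, Cn n) (Subtype.val : punctured n → Cn n) z (v k)) =
    fun k => (show Cn n from v k) := funext fun k => hv (v k)
  refine (congrArg (dzForm n) e1).trans (Eq.trans ?_ (congrArg (dzForm n) e2).symm)
  rw [dzForm_smul, hζ, one_mul]

/-! ### The blow-down map in charts -/

/-- A local inverse of `coverChart i` near `w`. -/
def rootChart (i : Fin n) (w y : Cn n) : Cn n :=
  (w i * (y i / w i ^ n) ^ ((n : ℂ)⁻¹)) • affineRep i y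

theorem rootChart_pow {i : Fin n} {w : Cn n} (hw : w i ≠ 0) (y : Cn n) (k : Fin n) :
    rootChart i w y k ^ n = y i * affineRep i y k ^ n := by
  rw [rootChart, PiLp.smul_apply, smul_eq_mul, mul_pow, mul_pow,
    Complex.cpow_nat_inv_pow _ (NeZero.ne n)]
  field_simp

theorem rootChart_apply_self_ne_zero {i : Fin n} {w : Cn n} (hw : w i ≠ 0) {y : Cn n}
    (hy : y i ≠ 0) : rootChart i w y i ≠ 0 := by
  intro h
  have := rootChart_pow hw y i
  rw [h] at this
  simp [NeZero.ne n, affineRep] at this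
  exact hy this.symm

theorem rootChart_ne_zero {i : Fin n} {w : Cn n} (hw : w i ≠ 0) {y : Cn n} (hy : y i ≠ 0) :
    rootChart i w y ≠ 0 := fun h =>
  rootChart_apply_self_ne_zero hw hy (by rw [h]; rfl)

theorem rootChart_coverChart {i : Fin n} {w : Cn n} (hw : w i ≠ 0) :
    rootChart i w (coverChart i w) = w := by
  ext k
  rw [rootChart, PiLp.smul_apply, coverChart_apply, if_pos rfl, div_self (pow_ne_zero _ hw),
    Complex.one_cpow, mul_one, smul_eq_mul]
  by_cases hk : k = i
  · subst hk; simp [affineRep]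
  · simp [affineRep, hk, coverChart_apply]
    field_simp

theorem coverChart_rootChart {i : Fin n} {w : Cn n} (hw : w i ≠ 0) {y : Cn n} (hy : y i ≠ 0) :
    coverChart i (rootChart i w y) = y := by
  have hc : w i * (y i / w i ^ n) ^ ((n : ℂ)⁻¹) ≠ 0 := by
    refine mul_ne_zero hw ?_
    rw [Complex.cpow_ne_zero_iff]
    exact Or.inl (div_ne_zero hy (pow_ne_zero _ hw))
  ext k
  rw [coverChart_apply]
  by_cases hk : k = i
  · subst hk
    rw [if_pos rfl, rootChart_pow hw]
    simp [affineRep]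
  · rw [if_neg hk, rootChart, PiLp.smul_apply, PiLp.smul_apply, smul_eq_mul, smul_eq_mul,
      mul_div_mul_left _ _ hc]
    simp [affineRep, hk]

/-- The normalisation by `(wⁱ)ⁿ` makes the base of the power equal to 1 at `coverChart i w`, where
the principal branch is holomorphic. -/
theorem differentiableAt_rootChart {i : Fin n} {w : Cn n} (hw : w i ≠ 0) :
    DifferentiableAt ℂ (rootChart i w) (coverChart i w) := by
  have h1 : DifferentiableAt ℂ (fun y : Cn n => y i / w i ^ n) (coverChart i w) := by fun_prop
  have h2 : DifferentiableAt ℂ (fun y : Cn n => (y i / w i ^ n) ^ ((n : ℂ)⁻¹))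
      (coverChart i w) := by
    refine h1.cpow (differentiableAt_const _) ?_
    rw [coverChart_apply, if_pos rfl, div_self (pow_ne_zero _ hw)]
    simp
  have h3 : DifferentiableAt ℂ (affineRep i : Cn n → Cn n) (coverChart i w) := by
    rw [differentiableAt_piLp]
    exact fun k => (contDiff_affineRep i k).differentiable (by simp) _
  exact (h2.const_mul (w i)).smul h3

/-- `rootChart` is a local right inverse of `coverChart`, so its Jacobian determinant is inverse to
`n`. -/
theorem dzForm_fderiv_rootChart {i : Fin n} {w : Cn n} (hw : w i ≠ 0) (v : Fin n → Cn n) :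
    dzForm n (fun k => fderiv ℂ (rootChart i w) (coverChart i w) (v k)) =
      (n : ℂ)⁻¹ * dzForm n v := by
  have hn : (n : ℂ) ≠ 0 := by exact_mod_cast NeZero.ne n
  have h0 : HasFDerivAt (coverChart i) (coverDeriv i w) (rootChart i w (coverChart i w)) := by
    rw [rootChart_coverChart hw]
    exact hasFDerivAt_coverChart hw
  have h1 := h0.comp _ (differentiableAt_rootChart hw).hasFDerivAt
  have h2 : coverChart i ∘ rootChart i w =ᶠ[𝓝 (coverChart i w)] id := by
    have : ∀ᶠ y : Cn n in 𝓝 (coverChart i w), y i ≠ 0 :=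
      (isOpen_ne_fun (f := fun z : Cn n => z i) (by fun_prop) continuous_const).mem_nhds
        (by simp [coverChart_apply, hw])
    filter_upwards [this] with y hy
    exact coverChart_rootChart hw hy
  have h3 := h1.unique ((hasFDerivAt_id _).congr_of_eventuallyEq h2)
  have h4 : ∀ v, coverDeriv i w (fderiv ℂ (rootChart i w) (coverChart i w) v) = v := fun v =>
    DFunLike.congr_fun h3 v
  have h5 := dzForm_coverDeriv hw fun k => fderiv ℂ (rootChart i w) (coverChart i w) (v k)
  simp only [h4] at h5
  rw [h5]
  field_simp

end Forms

/-! ### Pulling the quotient form back along the blow-down map -/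

section BlowDown

variable {n : ℕ} [NeZero n]

theorem chart_symm_eq_cover {i : Fin n} {w : Cn n} (hw : w ≠ 0) {y : Cn n}
    (hwi : w i ≠ 0) (h : coverChart i w = y) : (chart i).symm y = cover n ⟨w, hw⟩ := by
  rw [← h]
  exact symm_coverChart (z := ⟨w, hw⟩) hwi

theorem blowDown_chart_symm {i : Fin n} {w : Cn n} (hw : w i ≠ 0) {y : Cn n} (hy : y i ≠ 0)
    {p : offZeroSection n} (hp : (p : OMinus n) = (chart i).symm y) :
    blowDown n p = quotientMap n ⟨rootChart i w y, rootChart_ne_zero hw hy⟩ := by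
  refine blowDown_eq _ _ ?_
  rw [hp, chart_symm_eq_cover (rootChart_ne_zero hw hy) (rootChart_apply_self_ne_zero hw hy)
    (coverChart_rootChart hw hy)]
  exact isRoot_cover _

theorem exists_cover_eq (p : offZeroSection n) : ∃ w : punctured n, cover n w = p := by
  obtain ⟨w, h1, h2⟩ := exists_isRoot p
  refine ⟨w, Subtype.ext (Prod.ext ?_ h2)⟩
  ext k
  exact (one_mul _).trans (h1 k)

/-- In preferred charts the blow-down map is `ζ • rootChart` with `ζⁿ = 1`, so its Jacobian
determinant is `n⁻¹`, the coefficient of the volume form. -/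
theorem volumeForm_pullback (n : ℕ) [NeZero n] :
    (volumeForm n).pullback (Subtype.val : offZeroSection n → OMinus n) =
      (quotientForm n).pullback (blowDown n) := by
  ext1 p
  refine ContinuousAlternatingMap.ext fun v => ?_
  change (n : ℂ)⁻¹ * dzForm n (fun k => mfderiv 𝓘(ℂ, Cn n) 𝓘(ℂ, Cn n)
      (Subtype.val : offZeroSection n → OMinus n) p (v k)) =
    dzForm n (fun k => mfderiv 𝓘(ℂ, Cn n) 𝓘(ℂ, Cn n) (blowDown n) p (v k))
  obtain ⟨w, hw⟩ := exists_cover_eq p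
  set i := chartIndex (p : OMinus n) with hi
  have hps : (p : OMinus n) ∈ (chart i).source := mem_chart_chartIndex_source _
  have hwi : (w : Cn n) i ≠ 0 := (cover_mem_chart_source_iff i w).1 (hw ▸ hps)
  have hy0 : chartAt (Cn n) p p = coverChart i w := by
    rw [← chart_cover, hw]
    rfl
  have hbp : blowDown n p = quotientMap n w := blowDown_eq _ _ (hw ▸ isRoot_cover w)
  obtain ⟨ζ, hζ, hζw, h⟩ := exists_rootOfUnity_chart (chart_mem_atlas (Cn n) (blowDown n p))
    (z := w) (by rw [hbp]; exact mem_chart_source _ _)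
  have hrc : ContinuousAt (rootChart i (w : Cn n)) (coverChart i w) :=
    (differentiableAt_rootChart hwi).continuousAt
  have hne : ∀ᶠ y : Cn n in 𝓝 (coverChart i (w : Cn n)), y i ≠ 0 :=
    (isOpen_ne_fun (f := fun z : Cn n => z i) (by fun_prop) continuous_const).mem_nhds
      (by simp [coverChart_apply, hwi])
  have htar : ∀ᶠ y in 𝓝 (coverChart i (w : Cn n)),
      ζ • rootChart i (w : Cn n) y ∈ (chartAt (Cn n) (blowDown n p)).target := by
    refine (hrc.const_smul ζ).eventually_mem
      ((chartAt (Cn n) (blowDown n p)).open_target.mem_nhds ?_)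
    change ζ • rootChart i (w : Cn n) (coverChart i w) ∈ _
    rw [rootChart_coverChart hwi]
    exact hζw
  have hev : ∀ᶠ y in 𝓝 (coverChart i (w : Cn n)), ∀ q : offZeroSection n,
      (q : OMinus n) = (chart i).symm y → blowDown n q ∈ (chartAt (Cn n) (blowDown n p)).source ∧
        chartAt (Cn n) (blowDown n p) (blowDown n q) = ζ • rootChart i (w : Cn n) y := by
    filter_upwards [hne, htar] with y h1 h2 q hq
    rw [blowDown_chart_symm hwi h1 hq]
    exact h _ h2
  have hpc : ContinuousAt (fun q : offZeroSection n => chart i (q : OMinus n)) p :=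
    ((chart i).continuousAt hps).comp continuous_subtype_val.continuousAt
  have hpy : chart i (p : OMinus n) = coverChart i (w : Cn n) := hy0
  have hevp : ∀ᶠ q : offZeroSection n in 𝓝 p,
      blowDown n q ∈ (chartAt (Cn n) (blowDown n p)).source ∧
        chartAt (Cn n) (blowDown n p) (blowDown n q) =
          ζ • rootChart i (w : Cn n) (chart i (q : OMinus n)) := by
    have h1 := hpc.eventually (hpy.symm ▸ hev)
    have h2 : ∀ᶠ q : offZeroSection n in 𝓝 p, (q : OMinus n) ∈ (chart i).source :=
      continuous_subtype_val.continuousAt.eventually_mem ((chart i).open_source.mem_nhds hps)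
    filter_upwards [h1, h2] with q h1 h2
    exact h1 q ((chart i).left_inv h2).symm
  -- Continuity has to precede differentiation. The blow-down map is defined by a choice of roots,
  -- so it is recovered near `p` from its chart expression.
  have hcont : ContinuousAt (blowDown n) p := by
    set e := chartAt (Cn n) (blowDown n p)
    have h1 : ContinuousAt (fun q : offZeroSection n =>
        e.symm (ζ • rootChart i (w : Cn n) (chart i (q : OMinus n)))) p := by
      have h2 : ContinuousAt (fun q : offZeroSection n =>
          ζ • rootChart i (w : Cn n) (chart i (q : OMinus n))) p :=
        (ContinuousAt.comp (g := rootChart i (w : Cn n)) (by rw [hpy]; exact hrc) hpc).const_smul ζ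
      refine ContinuousAt.comp (g := e.symm) (e.continuousAt_symm ?_) h2
      rw [hpy, rootChart_coverChart hwi]
      exact hζw
    refine h1.congr ?_
    filter_upwards [hevp] with q hq
    rw [← hq.2, e.left_inv hq.1]
  have hd : ∀ v : Cn n, mfderiv 𝓘(ℂ, Cn n) 𝓘(ℂ, Cn n) (blowDown n) p v =
      ζ • fderiv ℂ (rootChart i (w : Cn n)) (coverChart i w) v := by
    intro v
    refine mfderiv_eq_of_charts hcont (F := fun y => ζ • rootChart i (w : Cn n) y)
      (F' := ζ • fderiv ℂ (rootChart i (w : Cn n)) (coverChart i w)) ?_ ?_ v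
    · have := chartAt_opens_symm (E := Cn n) p
      rw [hy0] at this ⊢
      filter_upwards [this, hev] with y h1 h2
      exact (h2 _ h1).2
    · rw [hy0]
      exact (differentiableAt_rootChart hwi).hasFDerivAt.const_smul ζ
  have hv : ∀ v : Cn n, mfderiv 𝓘(ℂ, Cn n) 𝓘(ℂ, Cn n)
      (Subtype.val : offZeroSection n → OMinus n) p v = v := mfderiv_val_opens p
  have e1 : (fun k => mfderiv 𝓘(ℂ, Cn n) 𝓘(ℂ, Cn n) (blowDown n) p (v k)) =
    fun k => ζ • fderiv ℂ (rootChart i (w : Cn n)) (coverChart i w) (v k) :=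
      funext fun k => hd (v k)
  have e2 : (fun k => mfderiv 𝓘(ℂ, Cn n) 𝓘(ℂ, Cn n)
      (Subtype.val : offZeroSection n → OMinus n) p (v k)) = v := funext fun k => hv (v k)
  refine (congrArg (fun u => (n : ℂ)⁻¹ * dzForm n u) e2).trans
    (Eq.trans ?_ (congrArg (dzForm n) e1).symm)
  refine Eq.trans ?_ (dzForm_smul ζ _).symm
  rw [hζ, one_mul]
  exact (dzForm_fderiv_rootChart hwi v).symm

end BlowDown

/-! ### The metric on `ℂⁿ ∖ 0` -/

section Radial

variable {n : ℕ}

/-- The conformal factor `(1 + aⁿ/tⁿ)^{1/n}`. -/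
def scale (n : ℕ) (a t : ℝ) : ℝ := (1 + a ^ n / t ^ n) ^ (1 / n : ℝ)

/-- The factor `aⁿ/(aⁿ + tⁿ)`. -/
def defect (n : ℕ) (a t : ℝ) : ℝ := a ^ n / (a ^ n + t ^ n)

theorem inner_eq_sum (z v : Cn n) : inner ℂ z v = ∑ k, (starRingEnd ℂ) (z k) * v k := by
  simp [PiLp.inner_apply, mul_comm]

theorem metricOnPunctured_eq (a : ℝ) (z v w : Cn n) :
    metricOnPunctured a z v w = scale n a (‖z‖ ^ 2) * (inner ℂ w v).re -
      scale n a (‖z‖ ^ 2) * defect n a (‖z‖ ^ 2) / ‖z‖ ^ 2 * (inner ℂ z v * inner ℂ w z).re := by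
  have h : ∑ μ, ∑ ν, metricMatrix a z μ ν * v μ * (starRingEnd ℂ) (w ν) =
      ((scale n a (‖z‖ ^ 2) : ℝ) : ℂ) * inner ℂ w v -
      ((scale n a (‖z‖ ^ 2) * defect n a (‖z‖ ^ 2) / ‖z‖ ^ 2 : ℝ) : ℂ) *
        (inner ℂ z v * inner ℂ w z) := by
    rw [inner_eq_sum w v, inner_eq_sum z v, inner_eq_sum w z, Finset.sum_mul_sum,
      Finset.mul_sum, Finset.mul_sum, ← Finset.sum_sub_distrib]
    refine Finset.sum_congr rfl fun μ _ => ?_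
    have h1 : ((scale n a (‖z‖ ^ 2) : ℝ) : ℂ) * ((starRingEnd ℂ) (w μ) * v μ) =
        ∑ ν, if μ = ν then ((scale n a (‖z‖ ^ 2) : ℝ) : ℂ) * ((starRingEnd ℂ) (w ν) * v μ)
          else 0 := by simp
    rw [h1, Finset.mul_sum, ← Finset.sum_sub_distrib]
    refine Finset.sum_congr rfl fun ν _ => ?_
    simp only [metricMatrix, scale, defect]
    push_cast
    split_ifs <;> ring
  rw [metricOnPunctured, h, Complex.sub_re, Complex.re_ofReal_mul, Complex.re_ofReal_mul]

variable [NeZero n] {a t : ℝ}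

/-- The logarithmic derivative of `(1 + aⁿ/tⁿ)^{1/n}` is `-d/t`, with `d` the defect; derivatives of
the metric thus stay rational in `p`, `d` and `t`. -/
theorem hasDerivAt_scale (ha : 0 < a) (ht : 0 < t) :
    HasDerivAt (scale n a) (-(scale n a t * defect n a t / t)) t := by
  have hn : (n : ℝ) ≠ 0 := by exact_mod_cast NeZero.ne n
  have h1 : HasDerivAt (fun t : ℝ => 1 + a ^ n / t ^ n)
      (-(n * (1 / t) * (a ^ n / t ^ n))) t := by
    have := ((hasDerivAt_const t (a ^ n)).div (hasDerivAt_pow n t) (by positivity)).const_add 1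
    refine this.congr_deriv ?_
    obtain ⟨m, hm⟩ := Nat.exists_eq_succ_of_ne_zero (NeZero.ne n)
    simp only [hm, Nat.succ_eq_add_one, Nat.add_sub_cancel]
    field_simp
    ring
  have h0 : 0 < 1 + a ^ n / t ^ n := by positivity
  have h2 := h1.rpow_const (p := 1 / n) (Or.inl h0.ne')
  refine h2.congr_deriv ?_
  rw [Real.rpow_sub_one h0.ne']
  simp only [scale, defect]
  field_simp
  ring

theorem hasDerivAt_scale_mul_defect (ha : 0 < a) (ht : 0 < t) :
    HasDerivAt (fun t => scale n a t * defect n a t / t)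
      (-(scale n a t * defect n a t / t * ((n + 1) - (n - 1) * defect n a t) / t)) t := by
  have h1 := hasDerivAt_scale (n := n) ha ht
  have h2 : HasDerivAt (defect n a) (-(n * defect n a t * (1 - defect n a t) / t)) t := by
    have := (hasDerivAt_const t (a ^ n)).div ((hasDerivAt_pow n t).const_add (a ^ n))
      (by positivity)
    refine this.congr_deriv ?_
    obtain ⟨m, hm⟩ := Nat.exists_eq_succ_of_ne_zero (NeZero.ne n)
    simp only [hm, Nat.succ_eq_add_one, Nat.add_sub_cancel, defect]
    field_simp
    ring
  refine ((h1.mul h2).div (hasDerivAt_id t) ht.ne').congr_deriv ?_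
  simp only [id, Pi.mul_apply]
  field_simp
  ring

/-- The Christoffel symbols of `metricOnPunctured`. -/
def radialChristoffel (a : ℝ) (z u v : Cn n) : Cn n :=
  (-(defect n a (‖z‖ ^ 2) / ‖z‖ ^ 2 : ℝ) : ℂ) • (inner ℂ z u • v + inner ℂ z v • u) +
    (((n + 1) * defect n a (‖z‖ ^ 2) / (‖z‖ ^ 2) ^ 2 : ℝ) : ℂ) • (inner ℂ z u * inner ℂ z v) • z

theorem radialChristoffel_comm (a : ℝ) (z u v : Cn n) :
    radialChristoffel a z u v = radialChristoffel a z v u := by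
  rw [radialChristoffel, radialChristoffel, add_comm (inner ℂ z u • v),
    mul_comm (inner ℂ z u)]

/-- The trace of `Γ(u, ·)` has a scalar part `-(d/t) n ⟨z, u⟩` and two rank-one parts, `-(d/t) ⟨z,
u⟩` and `(n + 1)(d/t²) ⟨z, u⟩ t`, where `t = ‖z‖²`. They cancel. -/
theorem sum_dzForm_radialChristoffel (a : ℝ) {z : Cn n} (hz : z ≠ 0) (u : Cn n)
    (W : Fin n → Cn n) :
    ∑ j, dzForm n (Function.update W j (radialChristoffel a z u (W j))) = 0 := by
  set d := defect n a (‖z‖ ^ 2)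
  set α : Cn n →ₗ[ℂ] ℂ := (innerSL ℂ z).toLinearMap
  have h1 : ∀ j, radialChristoffel a z u (W j) =
      (-(d / ‖z‖ ^ 2 : ℝ) * inner ℂ z u : ℂ) • W j +
        ((-(d / ‖z‖ ^ 2 : ℝ) : ℂ) • α (W j) • u +
          ((((n + 1) * d / (‖z‖ ^ 2) ^ 2 : ℝ) : ℂ) * inner ℂ z u) • α (W j) • z) := fun j => by
    simp only [radialChristoffel, smul_add, smul_smul, mul_assoc]
    rw [add_assoc]
    rfl
  have h2 : ∀ (c : ℂ) (x : Cn n), ∑ j, dzForm n (Function.update W j (c • α (W j) • x)) =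
      c * (α x * dzForm n W) := fun c x => by
    rw [← sum_mul_dzForm_update, Finset.mul_sum]
    refine Finset.sum_congr rfl fun j _ => ?_
    rw [ContinuousAlternatingMap.map_update_smul, smul_eq_mul]
  have hz2 : α z = (‖z‖ : ℂ) ^ 2 := inner_self_eq_norm_sq_to_K (𝕜 := ℂ) z
  have hz3 : (‖z‖ : ℂ) ≠ 0 := by exact_mod_cast norm_ne_zero_iff.2 hz
  simp only [h1, ContinuousAlternatingMap.map_update_add, Finset.sum_add_distrib]
  rw [sum_dzForm_update_smul, h2, h2, hz2]
  change _ * (_ * inner ℂ z u) * _ + (_ * (inner ℂ z u * _) + _) = 0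
  push_cast
  field_simp
  ring

theorem hasFDerivAt_normSq (z : Cn n) :
    ∃ T : Cn n →L[ℝ] ℝ, HasFDerivAt (fun z : Cn n => ‖z‖ ^ 2) T z ∧
      ∀ u, T u = 2 * (inner ℂ z u).re := by
  have h := (HasFDerivAt.inner (𝕜 := ℂ) (hasFDerivAt_id (𝕜 := ℝ) z) (hasFDerivAt_id z))
  have h2 := Complex.reCLM.hasFDerivAt.comp z h
  refine ⟨_, h2.congr_of_eventuallyEq (Filter.Eventually.of_forall fun x => ?_), fun u => ?_⟩
  · have := inner_self_eq_norm_sq (𝕜 := ℂ) x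
    simpa using this.symm
  · have : (inner ℂ u z).re = (inner ℂ z u).re := by
      rw [← inner_conj_symm, Complex.conj_re]
    simp [this]
    ring

/-- Metric compatibility of the explicit symbols. Together with `radialChristoffel_comm` it
characterises them as those of the Levi-Civita connection. -/
theorem fderiv_metricOnPunctured (ha : 0 < a) {z : Cn n} (hz : z ≠ 0) (v w : Cn n) :
    DifferentiableAt ℝ (fun z => metricOnPunctured a z v w) z ∧
    ∀ u, fderiv ℝ (fun z => metricOnPunctured a z v w) z u =
      metricOnPunctured a z (radialChristoffel a z u v) w +
        metricOnPunctured a z v (radialChristoffel a z u w) := by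
  have ht : 0 < ‖z‖ ^ 2 := by positivity
  obtain ⟨T, hT, hT'⟩ := hasFDerivAt_normSq z
  have hp := (hasDerivAt_scale (n := n) ha ht).comp_hasFDerivAt z hT
  have hq := (hasDerivAt_scale_mul_defect (n := n) ha ht).comp_hasFDerivAt z hT
  have hA := HasFDerivAt.inner (𝕜 := ℂ) (hasFDerivAt_id (𝕜 := ℝ) z) (hasFDerivAt_const v z)
  have hB := HasFDerivAt.inner (𝕜 := ℂ) (hasFDerivAt_const (𝕜 := ℝ) w z) (hasFDerivAt_id z)
  have hAB := Complex.reCLM.hasFDerivAt.comp z (hA.mul hB)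
  have hh := (hp.mul_const (inner ℂ w v).re).sub (hq.mul hAB)
  have hh2 := hh.congr_of_eventuallyEq (f₁ := fun z => metricOnPunctured a z v w)
    (Filter.Eventually.of_forall fun x => metricOnPunctured_eq a x v w)
  refine ⟨hh2.differentiableAt, fun u => ?_⟩
  rw [hh2.fderiv, metricOnPunctured_eq, metricOnPunctured_eq]
  have e1 : ∀ x y : Cn n, inner ℂ x y = (starRingEnd ℂ) (inner ℂ y x) :=
    fun x y => (inner_conj_symm x y).symm
  have e2 : inner ℂ z z = ((‖z‖ ^ 2 : ℝ) : ℂ) := by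
    rw [inner_self_eq_norm_sq_to_K (𝕜 := ℂ) z]
    push_cast
    rfl
  simp only [radialChristoffel, inner_add_left, inner_add_right, inner_smul_left,
    inner_smul_right, e2, sub_apply, smul_apply, add_apply, ContinuousLinearMap.comp_apply,
    ContinuousLinearMap.prod_apply, fderivInnerCLM_apply, ContinuousLinearMap.coe_id', id,
    Complex.reCLM_apply, Function.comp_apply, Pi.mul_apply, zero_apply,
    inner_zero_left, inner_zero_right, hT', smul_eq_mul]
  rw [e1 w z, e1 w u, e1 u z]
  -- What remains is a rational identity in the real and imaginary parts of six inner products and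
  -- in `d`, `p`, `t`.
  generalize inner ℂ z u = zu, inner ℂ z v = zv, inner ℂ z w = zw, inner ℂ u v = uv,
    inner ℂ u w = uw, inner ℂ w v = wv, defect n a (‖z‖ ^ 2) = d, scale n a (‖z‖ ^ 2) = p
  generalize ‖z‖ ^ 2 = t at ht
  simp only [map_neg, map_mul, Complex.conj_ofReal, Complex.mul_re, Complex.mul_im,
    Complex.add_re, Complex.add_im, Complex.neg_re, Complex.neg_im, Complex.conj_re,
    Complex.conj_im, Complex.ofReal_re, Complex.ofReal_im, Complex.zero_re, Complex.zero_im]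
  field_simp
  ring

end Radial

/-! ### The metric in the standard charts -/

section ChartMetric

variable {n : ℕ}

/-- The projection that forgets the `i`-th coordinate. -/
def dropCoord (i : Fin n) : Cn n →ₗ[ℂ] Cn n where
  toFun v := WithLp.toLp 2 fun k => if k = i then 0 else v k
  map_add' v w := by ext k; by_cases hk : k = i <;> simp [hk]
  map_smul' c v := by ext k; by_cases hk : k = i <;> simp [hk]

theorem dropCoord_apply (i k : Fin n) (v : Cn n) :
    dropCoord i v k = if k = i then 0 else v k := rfl

/-- The component of `v` along the tautological line. -/
def lineCoeff (i : Fin n) (y : Cn n) : Cn n →ₗ[ℂ] ℂ :=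
  ((‖affineRep i y‖ ^ 2 : ℝ) : ℂ)⁻¹ • (innerSL ℂ (affineRep i y)).toLinearMap ∘ₗ dropCoord i

theorem lineCoeff_apply (i : Fin n) (y v : Cn n) :
    lineCoeff i y v =
      ((‖affineRep i y‖ ^ 2 : ℝ) : ℂ)⁻¹ * inner ℂ (affineRep i y) (dropCoord i v) := rfl

/-- The component of `v` orthogonal to the tautological line. -/
def horizontalPart (i : Fin n) (y : Cn n) : Cn n →ₗ[ℂ] Cn n :=
  dropCoord i - (lineCoeff i y).smulRight (affineRep i y)

theorem horizontalPart_apply (i : Fin n) (y v : Cn n) :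
    horizontalPart i y v = dropCoord i v - lineCoeff i y v • affineRep i y := rfl

/-- The vertical component of `v`. -/
def verticalPart (i : Fin n) (y : Cn n) : Cn n →ₗ[ℂ] ℂ :=
  (n : ℂ)⁻¹ • (EuclideanSpace.proj i : Cn n →L[ℂ] ℂ).toLinearMap + y i • lineCoeff i y

theorem verticalPart_apply (i : Fin n) (y v : Cn n) :
    verticalPart i y v = (n : ℂ)⁻¹ * v i + y i * lineCoeff i y v := rfl

/-- The value of `aⁿ + uⁿ` in the `i`-th chart. -/
def radius (a : ℝ) (i : Fin n) (y : Cn n) : ℝ :=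
  a ^ n + ‖y i‖ ^ 2 * (‖affineRep i y‖ ^ 2) ^ n

/-- The weight of the horizontal part. -/
def horizontalWeight (a : ℝ) (i : Fin n) (y : Cn n) : ℝ :=
  radius a i y ^ (1 / n : ℝ) / ‖affineRep i y‖ ^ 2

/-- The weight of the vertical part. -/
def verticalWeight (a : ℝ) (i : Fin n) (y : Cn n) : ℝ :=
  radius a i y ^ (1 / n : ℝ) / radius a i y * (‖affineRep i y‖ ^ 2) ^ n

/-- The Calabi-Eguchi-Hanson metric in the `i`-th chart. -/
def chartMetric (a : ℝ) (i : Fin n) (y : Cn n) : Cn n →L[ℝ] Cn n →L[ℝ] ℝ :=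
  LinearMap.toContinuousLinearMap
    (LinearMap.toContinuousLinearMap.toLinearMap ∘ₗ
      LinearMap.mk₂ ℝ (fun v w => horizontalWeight a i y *
          (inner ℂ (horizontalPart i y w) (horizontalPart i y v)).re +
        verticalWeight a i y *
          (verticalPart i y v * (starRingEnd ℂ) (verticalPart i y w)).re)
      (fun v v' w => by simp only [map_add, inner_add_right, Complex.add_re, add_mul]; ring)
      (fun c v w => by
        simp only [LinearMap.map_smul_of_tower, inner_smul_right_eq_smul, Complex.smul_re,
          smul_mul_assoc, smul_eq_mul]; ring)
      (fun v w w' => by simp only [map_add, inner_add_left, Complex.add_re, mul_add]; ring)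
      (fun c v w => by
        have h : horizontalPart i y (c • w) = (c : ℂ) • horizontalPart i y w := by
          rw [← map_smul]; rfl
        have h' : verticalPart i y (c • w) = (c : ℂ) * verticalPart i y w := by
          rw [← smul_eq_mul, ← map_smul]; rfl
        rw [h, h', inner_smul_left, map_mul, Complex.conj_ofReal, mul_left_comm,
          Complex.re_ofReal_mul, Complex.re_ofReal_mul, smul_eq_mul]
        ring))

theorem chartMetric_apply (a : ℝ) (i : Fin n) (y v w : Cn n) :
    chartMetric a i y v w = horizontalWeight a i y *
          (inner ℂ (horizontalPart i y w) (horizontalPart i y v)).re +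
        verticalWeight a i y *
          (verticalPart i y v * (starRingEnd ℂ) (verticalPart i y w)).re := rfl

theorem chartMetric_symm (a : ℝ) (i : Fin n) (y v w : Cn n) :
    chartMetric a i y v w = chartMetric a i y w v := by
  rw [chartMetric_apply, chartMetric_apply, ← inner_conj_symm, Complex.conj_re]
  congr 2
  simp only [Complex.mul_re, Complex.conj_re, Complex.conj_im]
  ring

variable {a : ℝ}

theorem norm_affineRep_pos (i : Fin n) (y : Cn n) : 0 < ‖affineRep i y‖ :=
  norm_pos_iff.2 (affineRep_ne_zero i y)

theorem radius_pos (ha : 0 < a) (i : Fin n) (y : Cn n) : 0 < radius a i y := by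
  unfold radius; positivity

theorem horizontalWeight_pos (ha : 0 < a) (i : Fin n) (y : Cn n) :
    0 < horizontalWeight a i y := by
  have := radius_pos ha i y
  have := norm_affineRep_pos i y
  unfold horizontalWeight; positivity

theorem verticalWeight_pos (ha : 0 < a) (i : Fin n) (y : Cn n) :
    0 < verticalWeight a i y := by
  have := radius_pos ha i y
  have := norm_affineRep_pos i y
  unfold verticalWeight; positivity

theorem chartMetric_pos (ha : 0 < a) (i : Fin n) (y : Cn n) {v : Cn n} (hv : v ≠ 0) :
    0 < chartMetric a i y v v := by
  have h1 := horizontalWeight_pos ha i y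
  have h2 := verticalWeight_pos ha i y
  have e1 : (inner ℂ (horizontalPart i y v) (horizontalPart i y v)).re =
      ‖horizontalPart i y v‖ ^ 2 := by
    simpa using inner_self_eq_norm_sq (𝕜 := ℂ) (horizontalPart i y v)
  have e2 : (verticalPart i y v * (starRingEnd ℂ) (verticalPart i y v)).re =
      ‖verticalPart i y v‖ ^ 2 := by
    rw [Complex.mul_conj, Complex.ofReal_re, Complex.normSq_eq_norm_sq]
  rw [chartMetric_apply, e1, e2]
  by_cases hh : horizontalPart i y v = 0
  -- The `i`-th coordinate of the horizontal part is `-lineCoeff`. Once both vanish, only `vⁱ` can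
  -- be nonzero, and the vertical part detects it.
  · have hl : lineCoeff i y v = 0 := by
      have := congrArg (fun x : Cn n => x i) hh
      simpa [horizontalPart_apply, dropCoord_apply, affineRep] using this
    have hd : dropCoord i v = 0 := by
      simpa [horizontalPart_apply, hl] using hh
    have hvi : v i ≠ 0 := by
      intro h0
      apply hv
      ext k
      by_cases hk : k = i
      · rw [hk, h0]; rfl
      · have := congrArg (fun x : Cn n => x k) hd
        simpa [dropCoord_apply, hk] using this
    have hn : (n : ℂ) ≠ 0 := by exact_mod_cast i.pos.ne'
    have : 0 < ‖verticalPart i y v‖ := by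
      rw [norm_pos_iff, verticalPart_apply, hl, mul_zero, add_zero]
      exact mul_ne_zero (inv_ne_zero hn) hvi
    positivity
  · have : 0 < ‖horizontalPart i y v‖ := norm_pos_iff.2 hh
    positivity

theorem contDiff_affineRep_real (i : Fin n) : ContDiff ℝ ∞ (affineRep i : Cn n → Cn n) := by
  rw [contDiff_piLp]
  exact fun k => ((contDiff_affineRep i k).restrict_scalars ℝ).of_le (by simp)

theorem contDiff_normSq_affineRep (i : Fin n) :
    ContDiff ℝ ∞ (fun y : Cn n => ‖affineRep i y‖ ^ 2) := by
  have h := Complex.reCLM.contDiff.comp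
    ((contDiff_affineRep_real i).inner ℂ (contDiff_affineRep_real i))
  convert h using 1
  ext y
  simpa using (inner_self_eq_norm_sq (𝕜 := ℂ) (affineRep i y)).symm

theorem contDiff_coord_real (i : Fin n) : ContDiff ℝ ∞ (fun y : Cn n => y i) :=
  ((EuclideanSpace.proj i : Cn n →L[ℂ] ℂ).contDiff.restrict_scalars ℝ)

theorem contDiff_radius (a : ℝ) (i : Fin n) : ContDiff ℝ ∞ (radius a i) :=
  contDiff_const.add (((contDiff_coord_real i).norm_sq ℝ).mul
    ((contDiff_normSq_affineRep i).pow n))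

theorem contDiff_lineCoeff (i : Fin n) (v : Cn n) :
    ContDiff ℝ ∞ (fun y => lineCoeff i y v) := by
  have h1 : ContDiff ℝ ∞ (fun y : Cn n => ((‖affineRep i y‖ ^ 2 : ℝ) : ℂ)) :=
    Complex.ofRealCLM.contDiff.comp (contDiff_normSq_affineRep i)
  refine (h1.inv fun y => ?_).mul ((contDiff_affineRep_real i).inner ℂ contDiff_const)
  have := norm_affineRep_pos i y
  exact_mod_cast (by positivity : ‖affineRep i y‖ ^ 2 ≠ 0)

theorem contDiff_horizontalPart (i : Fin n) (v : Cn n) :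
    ContDiff ℝ ∞ (fun y => horizontalPart i y v) :=
  contDiff_const.sub ((contDiff_lineCoeff i v).smul (contDiff_affineRep_real i))

theorem contDiff_verticalPart (i : Fin n) (v : Cn n) :
    ContDiff ℝ ∞ (fun y => verticalPart i y v) :=
  contDiff_const.add ((contDiff_coord_real i).mul (contDiff_lineCoeff i v))

/-- The only non-polynomial operations are a real power of `radius`, which is at least `aⁿ > 0` even
where `yⁱ = 0`, and division by `radius` or by the positive `‖affineRep i y‖²`. -/
theorem contDiff_chartMetric (ha : 0 < a) (i : Fin n) : ContDiff ℝ ∞ (chartMetric a i) := by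
  have hr : ContDiff ℝ ∞ (fun y => radius a i y ^ (1 / n : ℝ)) :=
    (contDiff_radius a i).rpow_const_of_ne fun y => (radius_pos ha i y).ne'
  have hN : ∀ y : Cn n, ‖affineRep i y‖ ^ 2 ≠ 0 := fun y =>
    pow_ne_zero _ (norm_affineRep_pos i y).ne'
  refine contDiff_clm_apply_iff.2 fun v => contDiff_clm_apply_iff.2 fun w => ?_
  simp only [chartMetric_apply]
  refine ((hr.div (contDiff_normSq_affineRep i) hN).mul ?_).add
    (((hr.div (contDiff_radius a i) fun y => (radius_pos ha i y).ne').mul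
      ((contDiff_normSq_affineRep i).pow n)).mul ?_)
  · exact Complex.reCLM.contDiff.comp
      ((contDiff_horizontalPart i w).inner ℂ (contDiff_horizontalPart i v))
  · exact Complex.reCLM.contDiff.comp ((contDiff_verticalPart i v).mul
      (Complex.conjCLE.contDiff.comp (contDiff_verticalPart i w)))

end ChartMetric

/-! ### Comparison of the chart metric with the metric on `ℂⁿ ∖ 0` -/

section Pullback

variable {n : ℕ} {a : ℝ}

theorem affineRep_coverChart {i : Fin n} {z : Cn n} (hz : z i ≠ 0) :
    affineRep i (coverChart i z) = (z i)⁻¹ • z := by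
  ext k
  by_cases hk : k = i
  · subst hk; simp [affineRep, hz]
  · simp [affineRep, hk, coverChart_apply, div_eq_inv_mul]

theorem dropCoord_coverDeriv {i : Fin n} {z : Cn n} (hz : z i ≠ 0) (v : Cn n) :
    dropCoord i (coverDeriv i z v) = (z i)⁻¹ • (v - (v i / z i) • z) := by
  ext k
  by_cases hk : k = i
  · subst hk
    simp [dropCoord_apply, hz]
  · simp only [dropCoord_apply, hk, if_false, coverDeriv_apply_of_ne hk hz, PiLp.smul_apply,
      PiLp.sub_apply, smul_eq_mul]
    field_simp

theorem lineCoeff_coverDeriv {i : Fin n} {z : Cn n} (hz : z i ≠ 0) (v : Cn n) :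
    lineCoeff i (coverChart i z) (coverDeriv i z v) =
      inner ℂ z v / (‖z‖ ^ 2 : ℝ) - v i / z i := by
  have h0 : z ≠ 0 := fun h => hz (by rw [h]; rfl)
  have h1 : (‖z‖ : ℂ) ≠ 0 := by exact_mod_cast norm_ne_zero_iff.2 h0
  have h2 : (‖z i‖ : ℂ) ≠ 0 := by exact_mod_cast norm_ne_zero_iff.2 hz
  have h3 : (starRingEnd ℂ) (z i) ≠ 0 := by simpa using hz
  have e2 : inner ℂ z z = (‖z‖ : ℂ) ^ 2 := inner_self_eq_norm_sq_to_K (𝕜 := ℂ) z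
  have e3 : (‖z i‖ : ℂ) ^ 2 = z i * (starRingEnd ℂ) (z i) := (Complex.mul_conj' _).symm
  rw [lineCoeff_apply, affineRep_coverChart hz, dropCoord_coverDeriv hz, norm_smul, norm_inv,
    inner_smul_left, inner_smul_right, inner_sub_right, inner_smul_right, e2, map_inv₀]
  push_cast
  rw [mul_pow, inv_pow, e3]
  field_simp

/-- The horizontal part sees exactly the component of `v` orthogonal to `z`, and
`verticalPart_coverDeriv` exactly the component along `z`. -/
theorem horizontalPart_coverDeriv {i : Fin n} {z : Cn n} (hz : z i ≠ 0) (v : Cn n) :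
    horizontalPart i (coverChart i z) (coverDeriv i z v) =
      (z i)⁻¹ • (v - (inner ℂ z v / (‖z‖ ^ 2 : ℝ)) • z) := by
  rw [horizontalPart_apply, lineCoeff_coverDeriv hz, dropCoord_coverDeriv hz,
    affineRep_coverChart hz]
  module

theorem verticalPart_coverDeriv {i : Fin n} {z : Cn n} (hz : z i ≠ 0) (v : Cn n) :
    verticalPart i (coverChart i z) (coverDeriv i z v) =
      z i ^ n * (inner ℂ z v / (‖z‖ ^ 2 : ℝ)) := by
  have hn : (n : ℂ) ≠ 0 := by exact_mod_cast i.pos.ne'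
  rw [verticalPart_apply, lineCoeff_coverDeriv hz, coverDeriv_apply_self hz, coverChart_apply,
    if_pos rfl]
  have : z i ^ n = z i ^ (n - 1) * z i := by
    rw [← pow_succ, Nat.sub_add_cancel i.pos]
  rw [this]
  field_simp
  ring

theorem radius_coverChart {i : Fin n} {z : Cn n} (hz : z i ≠ 0) :
    radius a i (coverChart i z) = a ^ n + (‖z‖ ^ 2) ^ n := by
  have h2 : ‖z i‖ ≠ 0 := norm_ne_zero_iff.2 hz
  rw [radius, affineRep_coverChart hz, coverChart_apply, if_pos rfl, norm_smul, norm_pow, norm_inv]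
  congr 1
  rw [← pow_mul, mul_comm n 2, pow_mul, ← mul_pow]
  congr 1
  field_simp

theorem rpow_radius_coverChart (ha : 0 < a) {i : Fin n} {z : Cn n} (hz : z i ≠ 0) :
    radius a i (coverChart i z) ^ (1 / n : ℝ) = scale n a (‖z‖ ^ 2) * ‖z‖ ^ 2 := by
  have h0 : z ≠ 0 := fun h => hz (by rw [h]; rfl)
  have ht : 0 < ‖z‖ ^ 2 := by positivity
  have e : a ^ n + (‖z‖ ^ 2) ^ n = (1 + a ^ n / (‖z‖ ^ 2) ^ n) * (‖z‖ ^ 2) ^ n := by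
    field_simp
    ring
  rw [radius_coverChart hz, e, Real.mul_rpow (by positivity) (by positivity), one_div,
    Real.pow_rpow_inv_natCast ht.le i.pos.ne', scale, one_div]

/-- Orthogonal splitting along `z`: the horizontal weight becomes `p ‖zⁱ‖²`, and the vertical weight
produces `p (1 - d)` on the radial component. -/
theorem chartMetric_coverDeriv (ha : 0 < a) {i : Fin n} {z : Cn n} (hz : z i ≠ 0) (v w : Cn n) :
    chartMetric a i (coverChart i z) (coverDeriv i z v) (coverDeriv i z w) =
      metricOnPunctured a z v w := by
  have h0 : z ≠ 0 := fun h => hz (by rw [h]; rfl)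
  have h1 : ‖z‖ ≠ 0 := norm_ne_zero_iff.2 h0
  have h2 : ‖z i‖ ≠ 0 := norm_ne_zero_iff.2 hz
  have ht : 0 < ‖z‖ ^ 2 := by positivity
  have e2 : inner ℂ z z = ((‖z‖ ^ 2 : ℝ) : ℂ) := by
    rw [inner_self_eq_norm_sq_to_K (𝕜 := ℂ) z]; push_cast; rfl
  have e4 : inner ℂ w z = (starRingEnd ℂ) (inner ℂ z w) := (inner_conj_symm w z).symm
  have hN : ‖affineRep i (coverChart i z)‖ ^ 2 = ‖z‖ ^ 2 / ‖z i‖ ^ 2 := by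
    rw [affineRep_coverChart hz, norm_smul, norm_inv]
    field_simp
  have eh : (inner ℂ (horizontalPart i (coverChart i z) (coverDeriv i z w))
      (horizontalPart i (coverChart i z) (coverDeriv i z v))).re =
      (‖z i‖ ^ 2)⁻¹ * ((inner ℂ w v).re - (inner ℂ z v * inner ℂ w z).re / ‖z‖ ^ 2) := by
    have : inner ℂ (horizontalPart i (coverChart i z) (coverDeriv i z w))
      (horizontalPart i (coverChart i z) (coverDeriv i z v)) =
      (((‖z i‖ ^ 2)⁻¹ : ℝ) : ℂ) * (inner ℂ w v - (((‖z‖ ^ 2)⁻¹ : ℝ) : ℂ) *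
        (inner ℂ z v * inner ℂ w z)) := by
      have e3 : (((‖z i‖ ^ 2)⁻¹ : ℝ) : ℂ) = (starRingEnd ℂ) (z i)⁻¹ * (z i)⁻¹ := by
        push_cast
        rw [map_inv₀, ← Complex.mul_conj', mul_inv, mul_comm]
      have h3 : (‖z‖ : ℂ) ≠ 0 := by exact_mod_cast h1
      rw [e3, horizontalPart_coverDeriv hz, horizontalPart_coverDeriv hz, inner_smul_left,
        inner_smul_right, inner_sub_left, inner_sub_right, inner_sub_right, inner_smul_left,
        inner_smul_left, inner_smul_right, inner_smul_right, e2, e4, map_div₀, Complex.conj_ofReal]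
      push_cast
      field_simp
      ring
    rw [this, Complex.re_ofReal_mul, Complex.sub_re, Complex.re_ofReal_mul]
    ring
  have ev : (verticalPart i (coverChart i z) (coverDeriv i z v) *
      (starRingEnd ℂ) (verticalPart i (coverChart i z) (coverDeriv i z w))).re =
      (‖z i‖ ^ 2) ^ n / (‖z‖ ^ 2) ^ 2 * (inner ℂ z v * inner ℂ w z).re := by
    have : verticalPart i (coverChart i z) (coverDeriv i z v) *
      (starRingEnd ℂ) (verticalPart i (coverChart i z) (coverDeriv i z w)) =
      (((‖z i‖ ^ 2) ^ n / (‖z‖ ^ 2) ^ 2 : ℝ) : ℂ) * (inner ℂ z v * inner ℂ w z) := by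
      rw [verticalPart_coverDeriv hz, verticalPart_coverDeriv hz, e4, map_mul, map_pow, map_div₀,
        Complex.conj_ofReal]
      push_cast
      rw [← Complex.mul_conj', mul_pow]
      ring
    rw [this, Complex.re_ofReal_mul]
  rw [chartMetric_apply, eh, ev, horizontalWeight, verticalWeight, hN,
    rpow_radius_coverChart ha hz, radius_coverChart hz, metricOnPunctured_eq, defect]
  generalize (inner ℂ z v * inner ℂ w z).re = r, (inner ℂ w v).re = s, scale n a (‖z‖ ^ 2) = p
  rw [div_pow]
  field_simp
  ring

/-- Off the zero section both sides pull back to the same metric on `ℂⁿ ∖ 0`; on it they agree by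
continuity. -/
theorem chartMetric_transition (ha : 0 < a) {i j : Fin n} {y : Cn n}
    (hy : (chart i).symm y ∈ (chart j).source) (v w : Cn n) :
    chartMetric a j (transition i j y) (fderiv ℂ (transition i j) y v)
      (fderiv ℂ (transition i j) y w) = chartMetric a i y v w := by
  refine eq_of_eventually_ne_zero (i := i)
    (f := fun y => chartMetric a j (transition i j y) (fderiv ℂ (transition i j) y v)
      (fderiv ℂ (transition i j) y w))
    (g := fun y => chartMetric a i y v w) ?_ ?_ ?_
  · have h1 : ContinuousAt (fderiv ℂ (transition i j)) y :=
      (contDiffAt_transition hy).continuousAt_fderiv (by simp)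
    have h2 : ContinuousAt (fun y => chartMetric a j (transition i j y)) y :=
      (contDiff_chartMetric ha j).continuous.continuousAt.comp
        (contDiffAt_transition hy).continuousAt
    exact (h2.clm_apply (h1.clm_apply continuousAt_const)).clm_apply
      (h1.clm_apply continuousAt_const)
  · exact ((contDiff_chartMetric ha i).continuous.continuousAt.clm_apply
      continuousAt_const).clm_apply continuousAt_const
  · have hop : ∀ᶠ y' in 𝓝 y, affineRep i y' j ≠ 0 :=
      (isOpen_affineRep_ne_zero i j).mem_nhds ((mem_transition_source_iff i j y).1 hy)
    filter_upwards [hop] with y' hy' hyi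
    obtain ⟨z, hz, rfl⟩ := exists_coverChart_eq hyi
    rw [← mem_transition_source_iff, symm_coverChart hz, cover_mem_chart_source_iff] at hy'
    obtain ⟨v, rfl⟩ := coverDeriv_surjective hz v
    obtain ⟨w, rfl⟩ := coverDeriv_surjective hz w
    rw [fderiv_transition_coverDeriv hz hy', fderiv_transition_coverDeriv hz hy',
      transition_coverChart j hz, chartMetric_coverDeriv ha hz, chartMetric_coverDeriv ha hy']

end Pullback

/-! ### The Calabi-Eguchi-Hanson metric -/

section GlobalMetric

variable {n : ℕ}

/-- The form has a positive minimum on the compact unit sphere, and homogeneity bounds the unit ball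
of `G`. The sphere is empty only when `E` is trivial. -/
theorem isVonNBounded_of_posDef {E : Type} [NormedAddCommGroup E] [NormedSpace ℝ E]
    [FiniteDimensional ℝ E] {G : E →L[ℝ] E →L[ℝ] ℝ} (hG : ∀ v, v ≠ 0 → 0 < G v v) :
    Bornology.IsVonNBounded ℝ {v : E | G v v < 1} := by
  rw [NormedSpace.isVonNBounded_iff]
  have hc : IsCompact (Metric.sphere (0 : E) 1) := isCompact_sphere 0 1
  rcases (Metric.sphere (0 : E) 1).eq_empty_or_nonempty with he | hne
  · have : Subsingleton E := by
      refine ⟨fun x y => ?_⟩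
      by_contra h
      have h' : ‖x - y‖ ≠ 0 := norm_ne_zero_iff.2 (sub_ne_zero.2 h)
      have : ‖x - y‖⁻¹ • (x - y) ∈ Metric.sphere (0 : E) 1 := by
        simp [norm_smul, h']
      rw [he] at this
      exact this
    exact (Set.toFinite _).isBounded
  · have hcont : Continuous fun v => G v v := G.continuous.clm_apply continuous_id
    obtain ⟨v₀, hv₀, hmin⟩ := hc.exists_isMinOn hne hcont.continuousOn
    have hv0 : v₀ ≠ 0 := by
      rintro rfl
      simp at hv₀
    have hpos := hG v₀ hv0
    rw [isBounded_iff_forall_norm_le]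
    refine ⟨Real.sqrt (G v₀ v₀)⁻¹, fun v hv => ?_⟩
    by_cases h0 : v = 0
    · simp [h0]
    have h1 : ‖v‖ ≠ 0 := norm_ne_zero_iff.2 h0
    have h2 := hmin (show ‖v‖⁻¹ • v ∈ Metric.sphere (0 : E) 1 by simp [norm_smul, h1])
    simp only [map_smul, smul_apply, smul_eq_mul, Set.mem_ofPred_eq] at h2 hv
    refine Real.le_sqrt_of_sq_le ?_
    rw [le_inv_comm₀ (by positivity) hpos]
    calc G v₀ v₀ ≤ _ := h2
      _ ≤ ‖v‖⁻¹ * (‖v‖⁻¹ * 1) := by gcongr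
      _ = (‖v‖ ^ 2)⁻¹ := by rw [mul_one, ← mul_inv, sq]

theorem tangentSymm_apply_eq {x p : OMinus n} (hp : p ∈ (chart (chartIndex x)).source) (v : Cn n) :
    tangentSymm x p v =
      fderiv ℂ (transition (chartIndex x) (chartIndex p)) (chart (chartIndex x) p) v := by
  rw [tangentSymm_eq_fderiv hp]
  have hs : (chart (chartIndex x)).symm (chart (chartIndex x) p) ∈
      (chart (chartIndex p)).source := by
    rw [(chart (chartIndex x)).left_inv hp]
    exact mem_chart_chartIndex_source p
  have := ((contDiffAt_transition hs).differentiableAt (by simp)).hasFDerivAt.restrictScalars ℝ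
  exact DFunLike.congr_fun this.fderiv v

theorem transition_chart {i j : Fin n} {p : OMinus n} (hp : p ∈ (chart i).source) :
    transition i j (chart i p) = chart j p := by
  rw [transition, (chart i).left_inv hp]

/-- The Calabi-Eguchi-Hanson metric on `𝒪(-n)`. -/
def calabiEguchiHanson (n : ℕ) {a : ℝ} (ha : 0 < a) : Metric n where
  inner p := chartMetric a (chartIndex p) (chart (chartIndex p) p)
  symm p v w := chartMetric_symm a (chartIndex p) (chart (chartIndex p) p) v w
  pos p v hv := chartMetric_pos ha (chartIndex p) (chart (chartIndex p) p) hv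
  isVonNBounded p := isVonNBounded_of_posDef (E := Cn n) fun v hv =>
    chartMetric_pos ha (chartIndex p) (chart (chartIndex p) p) hv
  contMDiff x := by
    refine (Trivialization.contMDiffAt_section_iff (IB := 𝓘(ℝ, Cn n)) (n := ∞)
      (e := trivializationAt (Cn n →L[ℝ] Cn n →L[ℝ] ℝ) _ x) (x₀ := x) (by simp)).2 ?_
    have h1 : ContMDiffAt 𝓘(ℝ, Cn n) 𝓘(ℝ, Cn n →L[ℝ] Cn n →L[ℝ] ℝ) ∞
        (fun p => chartMetric a (chartIndex x) (chart (chartIndex x) p)) x :=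
      (contDiff_chartMetric ha (chartIndex x)).contMDiff.contMDiffAt.comp x
        (contMDiffAt_of_mem_maximalAtlas (I := 𝓘(ℝ, Cn n)) (n := ∞)
          (IsManifold.chart_mem_maximalAtlas x) (mem_chart_source (Cn n) x))
    refine h1.congr_of_eventuallyEq ?_
    filter_upwards [(chartAt (Cn n) x).open_source.mem_nhds (mem_chart_source (Cn n) x)] with p hp
    ext v w
    refine (hom_trivializationAt_apply_tangent hp
      (chartMetric a (chartIndex p) (chart (chartIndex p) p)) v w).trans ?_
    have hs : (chart (chartIndex x)).symm (chart (chartIndex x) p) ∈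
        (chart (chartIndex p)).source := by
      rw [(chart (chartIndex x)).left_inv hp]
      exact mem_chart_chartIndex_source p
    -- The metric is defined pointwise through the preferred charts; invariance under transition
    -- maps replaces them by the single chart at `x`.
    rw [tangentSymm_apply_eq hp, tangentSymm_apply_eq hp, ← transition_chart hp]
    exact chartMetric_transition ha hs v w

theorem continuous_cover (n : ℕ) : Continuous (cover n) := by
  refine Continuous.subtype_mk (Continuous.prodMk ?_ ?_) _
  · exact (PiLp.continuous_toLp 2 _).comp (continuous_pi fun k => by fun_prop)
  · exact (mk_isQuotientMap n).continuous.comp (continuous_subtype_val.subtype_mk _)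

theorem mfderiv_cover (z : punctured n) (v : Cn n) :
    mfderiv 𝓘(ℝ, Cn n) 𝓘(ℝ, Cn n) (cover n) z v = coverDeriv (chartIndex (cover n z)) z v := by
  set i := chartIndex (cover n z)
  have hi : (z : Cn n) i ≠ 0 :=
    (cover_mem_chart_source_iff i z).1 (mem_chart_chartIndex_source _)
  refine mfderiv_eq_of_charts (continuous_cover n).continuousAt (F := coverChart i)
    (F' := (coverDeriv i z).restrictScalars ℝ) ?_
    ((hasFDerivAt_coverChart hi).restrictScalars ℝ) v
  filter_upwards [chartAt_opens_symm (E := Cn n) z] with y hy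
  have h1 : (((chartAt (Cn n) z).symm y : punctured n) : Cn n) = y := hy
  exact (chart_cover i _).trans (by rw [h1])

theorem isCalabiEguchiHanson_calabiEguchiHanson (n : ℕ) {a : ℝ} (ha : 0 < a) :
    IsCalabiEguchiHanson a (calabiEguchiHanson n ha) := by
  intro z v w
  set i := chartIndex (cover n z) with hi
  have hzi : (z : Cn n) i ≠ 0 :=
    (cover_mem_chart_source_iff i z).1 (mem_chart_chartIndex_source _)
  change chartMetric a i (chart i (cover n z)) _ _ = _
  refine (congrArg₂ (fun v w : Cn n => chartMetric a i (chart i (cover n z)) v w)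
    (mfderiv_cover z v) (mfderiv_cover z w)).trans ?_
  rw [chart_cover]
  exact chartMetric_coverDeriv ha hzi v w

end GlobalMetric

/-! ### The trace of the Christoffel symbols in the standard charts -/

section Trace

variable {n : ℕ} {a : ℝ}

theorem hasFDerivAt_dzForm {V : Fin n → Cn n → Cn n} {V' : Fin n → Cn n →L[ℝ] Cn n} {y : Cn n}
    (hV : ∀ k, HasFDerivAt (V k) (V' k) y) :
    ∃ L : Cn n →L[ℝ] ℂ, HasFDerivAt (fun y => dzForm n fun k => V k y) L y ∧
      ∀ u, L u = ∑ j, dzForm n (Function.update (fun k => V k y) j (V' j u)) := by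
  have h1 := ((dzForm n).toContinuousMultilinearMap.hasFDerivAt fun k => V k y).restrictScalars ℝ
  have h2 := h1.comp y (hasFDerivAt_pi.2 hV)
  refine ⟨_, h2, fun u => ?_⟩
  simp

/-- The second derivative of `coverChart`. -/
def coverDeriv₂ (i : Fin n) (z : Cn n) : Cn n →L[ℂ] Cn n →L[ℂ] Cn n := fderiv ℂ (coverDeriv i) z

theorem hasFDerivAt_coverDeriv {i : Fin n} {z : Cn n} (hz : z i ≠ 0) (v : Cn n) :
    HasFDerivAt (fun z => coverDeriv i z v)
      (((coverDeriv₂ i z).flip v).restrictScalars ℝ) z := by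
  have h1 : DifferentiableAt ℂ (coverDeriv i) z :=
    ((contDiffAt_coverChart hz).fderiv_right (m := ω) (by simp)).differentiableAt (by simp)
  have h2 := (h1.hasFDerivAt.clm_apply (hasFDerivAt_const v z)).restrictScalars ℝ
  refine h2.congr_fderiv ?_
  ext u
  simp [coverDeriv₂]

theorem coverDeriv₂_comm {i : Fin n} {z : Cn n} (hz : z i ≠ 0) (u v : Cn n) :
    coverDeriv₂ i z u v = coverDeriv₂ i z v u :=
  ((contDiffAt_coverChart hz).isSymmSndFDerivAt (by simp)).eq u v

theorem eventually_ne_zero {i : Fin n} {z : Cn n} (hz : z i ≠ 0) : ∀ᶠ z' in 𝓝 z, z' i ≠ 0 :=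
  (isOpen_ne_fun (f := fun z : Cn n => z i) (by fun_prop) continuous_const).mem_nhds hz

/-- This sum is the derivative, in direction `u`, of the determinant identity `dzForm_coverDeriv`,
whose right-hand side does not depend on `z`. -/
theorem sum_dzForm_coverDeriv₂ {i : Fin n} {z : Cn n} (hz : z i ≠ 0) (u : Cn n)
    (W : Fin n → Cn n) :
    ∑ j, dzForm n (Function.update (fun k => coverDeriv i z (W k)) j (coverDeriv₂ i z u (W j))) =
      0 := by
  obtain ⟨L, hL, hL'⟩ := hasFDerivAt_dzForm fun k => hasFDerivAt_coverDeriv hz (W k)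
  have h1 : (fun z => dzForm n fun k => coverDeriv i z (W k)) =ᶠ[𝓝 z]
      fun _ => n * dzForm n W := by
    filter_upwards [eventually_ne_zero hz] with z' hz'
    exact dzForm_coverDeriv hz' W
  have h2 := hL.unique ((hasFDerivAt_const _ _).congr_of_eventuallyEq h1)
  have h3 := hL' u
  rw [h2] at h3
  exact h3.symm

/-- The Christoffel symbols of `chartMetric`. -/
def chartChristoffel (a : ℝ) (i : Fin n) (y : Cn n) : Cn n →L[ℝ] Cn n →L[ℝ] Cn n :=
  christoffel (chartMetric a i y) (fderiv ℝ (chartMetric a i) y)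

theorem hasFDerivAt_chartMetric (ha : 0 < a) (i : Fin n) (y : Cn n) :
    HasFDerivAt (chartMetric a i) (fderiv ℝ (chartMetric a i) y) y :=
  ((contDiff_chartMetric ha i).differentiable (by simp) y).hasFDerivAt

theorem fderiv_chartMetric_symm (ha : 0 < a) (i : Fin n) (y u v w : Cn n) :
    fderiv ℝ (chartMetric a i) y u v w = fderiv ℝ (chartMetric a i) y u w v := by
  have h := hasFDerivAt_chartMetric ha i y
  have h1 := ((h.clm_apply (hasFDerivAt_const v _)).clm_apply (hasFDerivAt_const w _))
  have h2 := ((h.clm_apply (hasFDerivAt_const w _)).clm_apply (hasFDerivAt_const v _))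
  have h3 := h1.unique (h2.congr_of_eventuallyEq
    (Filter.Eventually.of_forall fun y => chartMetric_symm a i y v w))
  simpa using DFunLike.congr_fun h3 u

variable [NeZero n]

/-- Both sides differentiate `chartMetric_coverDeriv` in direction `u`; the second derivatives come
from the moving vectors `coverDeriv i z v` and `coverDeriv i z w`. -/
theorem fderiv_chartMetric_coverDeriv (ha : 0 < a) {i : Fin n} {z : Cn n} (hz : z i ≠ 0)
    (u v w : Cn n) :
    fderiv ℝ (chartMetric a i) (coverChart i z) (coverDeriv i z u) (coverDeriv i z v)
        (coverDeriv i z w) +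
      chartMetric a i (coverChart i z) (coverDeriv₂ i z u v) (coverDeriv i z w) +
      chartMetric a i (coverChart i z) (coverDeriv i z v) (coverDeriv₂ i z u w) =
    metricOnPunctured a z (radialChristoffel a z u v) w +
      metricOnPunctured a z v (radialChristoffel a z u w) := by
  have h0 : z ≠ 0 := fun h => hz (by rw [h]; rfl)
  have h1 := (hasFDerivAt_chartMetric ha i (coverChart i z)).comp z
    ((hasFDerivAt_coverChart hz).restrictScalars ℝ)
  have h2 := (h1.clm_apply (hasFDerivAt_coverDeriv hz v)).clm_apply (hasFDerivAt_coverDeriv hz w)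
  have h3 : (fun z => chartMetric a i (coverChart i z) (coverDeriv i z v) (coverDeriv i z w))
      =ᶠ[𝓝 z] fun z => metricOnPunctured a z v w := by
    filter_upwards [eventually_ne_zero hz] with z' hz'
    exact chartMetric_coverDeriv ha hz' v w
  obtain ⟨h4, h5⟩ := fderiv_metricOnPunctured ha h0 v w
  have h6 := DFunLike.congr_fun (h2.unique (h4.hasFDerivAt.congr_of_eventuallyEq h3)) u
  rw [← h5, ← h6]
  simp
  ring

/-- The transformation law of Christoffel symbols. Both sides are symmetric in `u`, `v` and satisfy
the same compatibility equation, so their difference vanishes by `eq_zero_of_symm_of_antisymm`. -/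
theorem chartChristoffel_coverDeriv (ha : 0 < a) {i : Fin n} {z : Cn n} (hz : z i ≠ 0)
    (u v : Cn n) :
    chartChristoffel a i (coverChart i z) (coverDeriv i z u) (coverDeriv i z v) =
      coverDeriv i z (radialChristoffel a z u v) - coverDeriv₂ i z u v := by
  have hpos : ∀ v, v ≠ 0 → 0 < chartMetric a i (coverChart i z) v v := fun v hv =>
    chartMetric_pos ha i _ hv
  have h := eq_zero_of_symm_of_antisymm (β := fun u v w => chartMetric a i (coverChart i z)
    (chartChristoffel a i (coverChart i z) (coverDeriv i z u) (coverDeriv i z v) -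
      (coverDeriv i z (radialChristoffel a z u v) - coverDeriv₂ i z u v)) (coverDeriv i z w))
    (fun u v w => by
      rw [chartChristoffel, christoffel_comm _ (fderiv_chartMetric_symm ha i _),
        radialChristoffel_comm, coverDeriv₂_comm hz])
    (fun u v w => by
      have h1 := fderiv_chartMetric_coverDeriv ha hz u v w
      have h2 := inner_christoffel_add hpos (chartMetric_symm a i _)
        (fderiv_chartMetric_symm ha i (coverChart i z)) (coverDeriv i z u) (coverDeriv i z v)
        (coverDeriv i z w)
      rw [← chartMetric_coverDeriv ha hz, ← chartMetric_coverDeriv ha hz, ← h2,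
        chartMetric_symm a i _ (coverDeriv i z v), chartMetric_symm a i _ (coverDeriv i z v),
        chartMetric_symm a i _ (coverDeriv i z v)] at h1
      simp only [map_sub, sub_apply, chartChristoffel]
      linarith)
  by_contra h0
  -- The difference is itself of the form `coverDeriv i z w`, so it can be tested against itself.
  obtain ⟨w, hw⟩ := coverDeriv_surjective hz
    (chartChristoffel a i (coverChart i z) (coverDeriv i z u) (coverDeriv i z v) -
      (coverDeriv i z (radialChristoffel a z u v) - coverDeriv₂ i z u v))
  have h1 := h u v w
  rw [hw] at h1
  exact (hpos _ (sub_ne_zero.2 h0)).ne' h1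

theorem sum_dzForm_chartChristoffel (ha : 0 < a) (i : Fin n) (y u : Cn n) (W : Fin n → Cn n) :
    ∑ j, dzForm n (Function.update W j (chartChristoffel a i y u (W j))) = 0 := by
  refine eq_of_eventually_ne_zero (i := i)
    (f := fun y => ∑ j, dzForm n (Function.update W j (chartChristoffel a i y u (W j))))
    (g := fun _ => 0) ?_ continuousAt_const (Filter.Eventually.of_forall fun y hy => ?_)
  · refine tendsto_finsetSum _ fun j _ => ?_
    have h1 : ContinuousAt (fun y => chartChristoffel a i y u (W j)) y :=
      continuousAt_christoffel (contDiff_chartMetric ha i).continuous.continuousAt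
        ((contDiff_chartMetric ha i).continuous_fderiv (by simp)).continuousAt
        (fun v hv => chartMetric_pos ha i y hv) u (W j)
    exact (dzForm n).cont.continuousAt.comp (continuousAt_const.update j h1)
  · obtain ⟨z, hz, rfl⟩ := exists_coverChart_eq hy
    obtain ⟨u, rfl⟩ := coverDeriv_surjective hz u
    choose V hV using fun k => coverDeriv_surjective hz (W k)
    obtain rfl : (fun k => coverDeriv i z (V k)) = W := funext hV
    -- In the frame `coverDeriv i z (V k)` the transformation law splits each term into a
    -- `radialChristoffel` part, scaled by the determinant `n`, and a second-derivative part. Each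
    -- sums to zero.
    have h1 : ∀ j, dzForm n (Function.update (fun k => coverDeriv i z (V k)) j
        (chartChristoffel a i (coverChart i z) (coverDeriv i z u) (coverDeriv i z (V j)))) =
        n * dzForm n (Function.update V j (radialChristoffel a z u (V j))) -
          dzForm n (Function.update (fun k => coverDeriv i z (V k)) j
            (coverDeriv₂ i z u (V j))) := fun j => by
      rw [chartChristoffel_coverDeriv ha hz, ContinuousAlternatingMap.map_update_sub,
        ← dzForm_coverDeriv hz]
      congr 2
      ext1 k
      by_cases hk : k = j
      · subst hk; simp
      · simp [hk]
    simp only [h1]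
    rw [Finset.sum_sub_distrib, ← Finset.mul_sum,
      sum_dzForm_radialChristoffel a (punctured_ne_zero z), sum_dzForm_coverDeriv₂ hz]
    simp

end Trace

/-! ### Parallelism of the volume form -/

section Parallel

variable {n : ℕ} {a : ℝ}

/-- Off the zero section the hypothesis fixes `g` on the vectors `coverDeriv i z v`, which exhaust
the tangent space; continuity of `g` does the rest. Hence parallelism can be proved for an arbitrary
such `g`. -/
theorem metricRep_eq_chartMetric (ha : 0 < a) {g : Metric n} (hg : IsCalabiEguchiHanson a g)
    (x : OMinus n) (y : Cn n) :
    metricRep g x ((chart (chartIndex x)).symm y) = chartMetric a (chartIndex x) y := by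
  set i := chartIndex x
  refine eq_of_eventually_ne_zero (i := i) (f := fun y => metricRep g x ((chart i).symm y))
    (g := chartMetric a i) ?_ (contDiff_chartMetric ha i).continuous.continuousAt
    (Filter.Eventually.of_forall fun y hy => ?_)
  · exact (contMDiffAt_metricRep g ((chart i).map_target (Set.mem_univ y))).continuousAt.comp
      ((chart i).continuousAt_symm (Set.mem_univ y))
  · obtain ⟨z, hz, rfl⟩ := exists_coverChart_eq hy
    have hp : cover n z ∈ (chart i).source := (cover_mem_chart_source_iff i z).2 hz
    have hz' : (z : Cn n) (chartIndex (cover n z)) ≠ 0 :=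
      (cover_mem_chart_source_iff _ z).1 (mem_chart_chartIndex_source _)
    rw [symm_coverChart hz]
    ext v w
    obtain ⟨v, rfl⟩ := coverDeriv_surjective hz v
    obtain ⟨w, rfl⟩ := coverDeriv_surjective hz w
    rw [chartMetric_coverDeriv ha hz, metricRep_apply, tangentSymm_apply_eq hp,
      tangentSymm_apply_eq hp, chart_cover, fderiv_transition_coverDeriv hz hz',
      fderiv_transition_coverDeriv hz hz']
    exact (congrArg₂ (fun v w : Cn n => metricAt g (cover n z) v w)
      (mfderiv_cover z v) (mfderiv_cover z w)).symm.trans (hg z v w)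

theorem christoffelAt_eq_chartChristoffel (ha : 0 < a) {g : Metric n}
    (hg : IsCalabiEguchiHanson a g) (x : OMinus n) :
    christoffelAt g x = chartChristoffel a (chartIndex x) (chart (chartIndex x) x) := by
  have h1 : metricAt g x = chartMetric a (chartIndex x) (chart (chartIndex x) x) := by
    rw [← metricRep_eq_chartMetric ha hg,
      (chart (chartIndex x)).left_inv (mem_chart_chartIndex_source x), metricRep_self]
  have h2 : metricDeriv g x =
      fderiv ℝ (chartMetric a (chartIndex x)) (chart (chartIndex x) x) := by
    refine (hasFDerivAt_metricRep g x).unique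
      ((hasFDerivAt_chartMetric ha _ _).congr_of_eventuallyEq ?_)
    exact Filter.Eventually.of_forall fun y => metricRep_eq_chartMetric ha hg x y
  rw [christoffelAt, h1, h2]
  rfl

/-- Transition maps have determinant 1, so the volume form keeps its constant coefficient in the
chart at `x` at all nearby points. -/
theorem dzForm_tangentTo {x p : OMinus n} (hp : p ∈ (chart (chartIndex x)).source)
    (v : Fin n → Cn n) : dzForm n (fun k => tangentTo x p (v k)) = dzForm n v := by
  have hs : (chart (chartIndex x)).symm (chart (chartIndex x) p) ∈
      (chart (chartIndex p)).source := by
    rw [(chart (chartIndex x)).left_inv hp]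
    exact mem_chart_chartIndex_source p
  have h := dzForm_fderiv_transition hs fun k => tangentTo x p (v k)
  simp only [← tangentSymm_apply_eq hp] at h
  rw [← h]
  congr 1
  ext1 k
  exact tangentSymm_tangentTo hp (v k)

theorem derivAt_volumeForm {x : OMinus n} {W : Fin n → OMinus n → Cn n}
    (hW : ∀ j, DifferentiableFieldAt (W j) x) (v : Cn n) :
    derivAt (fun p => volumeForm n p fun j => W j p) x v =
      ∑ j, volumeForm n x (Function.update (fun k => W k x) j (coordDeriv x (W j) v)) := by
  obtain ⟨L, hL, hL'⟩ := hasFDerivAt_dzForm fun k => hasFDerivAt_coordRep (hW k)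
  have h1 : (fun p => volumeForm n p fun j => W j p) =ᶠ[𝓝 x]
      fun p => (n : ℂ)⁻¹ * dzForm n fun j => coordRep x (W j) p := by
    filter_upwards [(chartAt (Cn n) x).open_source.mem_nhds (mem_chart_source (Cn n) x)] with p hp
    exact congrArg ((n : ℂ)⁻¹ * ·) (dzForm_tangentTo hp fun j => W j p).symm
  rw [derivAt_congr h1, derivAt_eq_of_hasFDerivAt (hL.const_mul (n : ℂ)⁻¹)]
  refine (congrArg ((n : ℂ)⁻¹ * ·) (hL' v)).trans ?_
  rw [Finset.mul_sum]
  refine Finset.sum_congr rfl fun j _ => ?_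
  simp only [(chartAt (Cn n) x).left_inv (mem_chart_source (Cn n) x), coordRep_self]
  rfl

theorem volumeForm_isParallel [NeZero n] (ha : 0 < a) {g : Metric n}
    (hg : IsCalabiEguchiHanson a g) {nabla : Connection n} (h : IsLeviCivita g nabla) :
    IsParallel nabla (volumeForm n) := by
  intro x W hW v
  have hW' : ∀ j, DifferentiableFieldAt (E := Cn n) (W j) x := hW
  have h1 : ∀ j, nabla (W j) x v =
      coordDeriv (E := Cn n) x (W j) v + christoffelAt (E := Cn n) g x v (W j x) := fun j =>
    (DFunLike.congr_fun (h.apply_eq (isLeviCivita_leviCivita g) (hW' j)) v).trans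
      (covDeriv_apply (E := Cn n) g (W j) x v)
  refine (derivAt_volumeForm hW' v).trans ?_
  -- The coordinate derivatives account for all of `d(η(W₁, …, Wₙ))` by `derivAt_volumeForm`; the
  -- Christoffel terms are left over and sum to zero.
  have h2 : ∀ j, volumeForm n x (Function.update (fun k => W k x) j (nabla (W j) x v)) =
      volumeForm n x (Function.update (fun k => W k x) j (coordDeriv (E := Cn n) x (W j) v)) +
      (n : ℂ)⁻¹ * dzForm n (Function.update (fun k => W k x) j
        (chartChristoffel a (chartIndex x) (chart (chartIndex x) x) v (W j x))) := fun j => by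
    rw [← christoffelAt_eq_chartChristoffel ha hg]
    refine (congrArg (fun u : Cn n => volumeForm n x (Function.update (fun k => W k x) j u))
      (h1 j)).trans ?_
    exact (volumeForm n x).map_update_add (fun k => W k x) j _ _
  rw [Finset.sum_congr rfl fun j _ => h2 j, Finset.sum_add_distrib, ← Finset.mul_sum]
  refine (add_eq_left.2 ?_).symm
  exact (congrArg ((n : ℂ)⁻¹ * ·) (sum_dzForm_chartChristoffel ha (chartIndex x)
    (chart (chartIndex x) x) v fun k => W k x)).trans (mul_zero _)

end Parallel

end CalabiEguchiHanson

end

theorem mainTheorem5 (n : ℕ) [NeZero n] :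
    ∃ ηQ : CalabiEguchiHanson.TopForm n (CalabiEguchiHanson.PuncturedQuotient n),
      ηQ.IsHolomorphic ∧
      ηQ.pullback (CalabiEguchiHanson.quotientMap n) =
        (CalabiEguchiHanson.stdForm n).pullback
          (Subtype.val : CalabiEguchiHanson.punctured n → CalabiEguchiHanson.Cn n) ∧
      ∃ η : CalabiEguchiHanson.TopForm n (CalabiEguchiHanson.OMinus n),
        η.IsHolomorphic ∧ (∀ x, η x ≠ 0) ∧
        η.pullback (Subtype.val : CalabiEguchiHanson.offZeroSection n →
            CalabiEguchiHanson.OMinus n) =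
          ηQ.pullback (CalabiEguchiHanson.blowDown n) ∧
        ∀ a : ℝ, 0 < a →
          (∃ g : CalabiEguchiHanson.Metric n, CalabiEguchiHanson.IsCalabiEguchiHanson a g) ∧
          ∀ g : CalabiEguchiHanson.Metric n, CalabiEguchiHanson.IsCalabiEguchiHanson a g →
            (∃ nabla, CalabiEguchiHanson.IsLeviCivita g nabla) ∧
            ∀ nabla, CalabiEguchiHanson.IsLeviCivita g nabla →
              CalabiEguchiHanson.IsParallel nabla η := by
  open CalabiEguchiHanson in
  exact ⟨quotientForm n, quotientForm_isHolomorphic n, quotientForm_pullback n, volumeForm n,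
    volumeForm_isHolomorphic n, volumeForm_ne_zero, volumeForm_pullback n, fun _ ha =>
      ⟨⟨calabiEguchiHanson n ha, isCalabiEguchiHanson_calabiEguchiHanson n ha⟩, fun g hg =>
        ⟨⟨leviCivita g, isLeviCivita_leviCivita g⟩, fun _ h => volumeForm_isParallel ha hg h⟩⟩⟩
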